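/- Let $\mathcal X$ be a finite universe with $|\mathcal X|\ge 2$. Databases are histograms $\mathcal D\in\mathbb N^{\mathcal X}$, adjacent if $\|\mathcal D-\mathcal D'\|_1\le 1$; a linear query is a vector $Q\in[0,1]^{\mathcal X}$ with $Q(\mathcal D)=\sum_x Q(x)\mathcal D(x)$. Let $n\ge1$, $k\in\mathbb N$ and $\epsilon,\delta,\beta\in(0,1]$ be public parameters. *Online query release mechanism.* Given an update rule $\mathbf U$ (an initial data structure $D^1$, a way to evaluate queries on data structures, and an update map) and a number $B>0$, put $\sigma=1000\sqrt B\log(4/\delta)/\epsilon$ and $T=4\sigma\log(2k/\beta)$. For $t=1,\dots,k$ the mechanism receives a linear query $Q_t$, chosen by an adaptive, possibly randomized adversary from the transcript so far. It draws independent noise $A_t\sim\mathrm{Lap}(\sigma)$ and computes $\hat a_t=Q_t(\mathcal D)+A_t$ and $f_t=Q_t(D^t)$. If $|\hat a_t-f_t|\le T$, it answers $f_t$ and keeps $D^{t+1}=D^t$; otherwise it answers $\hat a_t$ and sets $D^{t+1}=\mathbf U(D^t,Q_t,\hat a_t)$. It terminates (answers no further query) once the number of updates has reached $B$. It is $(\epsilon,\delta)$-differentially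 private if, against every adversary and for all adjacent $\mathcal D,\mathcal D'$ (of any sizes) and all events $S$, the adversary's view $V$ (its coins and the transcript) satisfies $\Pr[V(\mathcal D)\in S]\le e^{\epsilon}\Pr[V(\mathcal D')\in S]+\delta$. It is $(a,\beta)$-accurate if, against every adversary and for every $\mathcal D$ with $\|\mathcal D\|_1=n$, with probability at least $1-\beta$ all $k$ queries are answered, each with error at most $a$. *Multiplicative Weights mechanism with parameter $\alpha>0$.* Data structures are vectors $p\in\mathbb R^{\mathcal X}$, initially $p_x=1/|\mathcal X|$ for all $x$, with $Q(p)=n\sum_xQ(x)p_x$. The update of $p$ by $(Q,\hat a)$ is the normalization to total mass $1$ of $x\mapsto e^{-\eta r(x)}p_x$, where $\eta=\alpha/(2n)$, $r=Q$ if $\hat a<Q(p)$ and $r=1-Q$ otherwise. Take $B=4n^2\log|\mathcal X|/\alpha^2$. *Median Mechanism with parameter $\alpha>0$.* Let $m=\lceil n^2\log k/\alpha^2\rceil$. Data structures are finite collections $\mathbf D$ of databases, initially all databases of size $m$. $Q(\mathbf D)$ is the median over $E\in\mathbf D$ of the rescaled values $nQ(E)/\|E\|_1$. The update by $(Q,\hat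 a)$ removes every $E\in\mathbf D$ whose rescaled value is $\ge Q(\mathbf D)$ if $\hat a<Q(\mathbf D)$, and every $E$ whose rescaled value is $\le Q(\mathbf D)$ if $\hat a>Q(\mathbf D)$ (an empty collection is reset to the initial one). Take $B=m\log_2|\mathcal X|$. **Corollary.** There are absolute constants $K,K'>0$ such that, for all $\mathcal X,n,k,\epsilon,\delta,\beta$ as above: 1. If $k/\beta\ge2$, then for some $\alpha>0$ (determined by the public parameters) the Multiplicative Weights mechanism with parameter $\alpha$ is $(\epsilon,\delta)$-differentially private and $(a,\beta)$-accurate with $$a=K\,\frac{\sqrt n\,(\log|\mathcal X|)^{1/4}\sqrt{\log(4/\delta)\log(k/\beta)}}{\sqrt\epsilon}.$$ 2. If $k\ge2$, then for some $\alpha>0$ (determined by the public parameters) the Median Mechanism with parameter $\alpha$ is $(\epsilon,\delta)$-differentially private and $(a,\beta)$-accurate with $$a=K'\,\frac{\sqrt n\,(\log|\mathcal X|\log k)^{1/4}\sqrt{\log(4/\delta)\log(k/\beta)}}{\sqrt\epsilon}.$$ -/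

import Mathlib

open MeasureTheory

universe v u w

/-! ### Databases, queries, differential privacy -/

/-- A database over the universe `X`, as a histogram. -/
abbrev Database (X : Type*) := X → ℕ

/-- The number of elements of a database, i.e. the `ℓ₁` norm of the histogram. -/
def Database.size {X : Type*} [Fintype X] (D : Database X) : ℕ := ∑ x, D x

/-- Two histograms are adjacent if their `ℓ₁` distance is at most one. -/
def Database.Adjacent {X : Type*} [Fintype X] (D D' : Database X) : Prop :=
  ∑ x, |(D x : ℤ) - (D' x : ℤ)| ≤ 1

/-- A linear query: a vector in `[0,1]^X`. -/
abbrev LinearQuery (X : Type*) := X → Set.Icc (0 : ℝ) 1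

/-- The dot product of a linear query with a real vector indexed by the universe. -/
def LinearQuery.dot {X : Type*} [Fintype X] (Q : LinearQuery X) (v : X → ℝ) : ℝ :=
  ∑ x, (Q x : ℝ) * v x

/-- The value `Q(D)` of a linear query on a database. -/
def LinearQuery.onDatabase {X : Type*} [Fintype X] (Q : LinearQuery X) (D : Database X) : ℝ :=
  Q.dot (fun x => (D x : ℝ))

/-- A randomized algorithm, given by a law `P` of its coins and a map from databases and coins to
outputs, is `(ε, δ)`-differentially private. -/
def IsDifferentiallyPrivate {X Z Y : Type*} [Fintype X] [MeasurableSpace Z] [MeasurableSpace Y]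
    (P : Measure Z) (M : Database X → Z → Y) (ε δ : ℝ) : Prop :=
  ∀ D D' : Database X, D.Adjacent D' → ∀ S : Set Y, MeasurableSet S →
    P (M D ⁻¹' S) ≤ ENNReal.ofReal (Real.exp ε) * P (M D' ⁻¹' S) + ENNReal.ofReal δ

/-- The Laplace distribution centred at `0` with scale `b > 0`. -/
noncomputable def laplace (b : ℝ) : Measure ℝ :=
  volume.withDensity (fun x => ENNReal.ofReal (1 / (2 * b) * Real.exp (-|x| / b)))

/-! ### Interactive query release -/

/-- What the mechanism returns in a round: a real number, or the notice `Sum.inr ()` that it has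
terminated. -/
abbrev Answer := ℝ ⊕ Unit

/-- The transcript of the first `t` rounds: the query asked and the answer given in each round. -/
abbrev Transcript (X : Type*) (t : ℕ) := Fin t → LinearQuery X × Answer

/-- An adaptive adversary with private coins in `Ω`. In round `t` (counted from `0`) it chooses its
query from its coins and the transcript of the previous rounds. -/
structure Adversary (X Ω : Type*) [MeasurableSpace Ω] where
  query : (t : ℕ) → Ω × Transcript X t → LinearQuery X
  measurable_query : ∀ t, Measurable (query t)

/-- The algorithmic data of a database update rule with data structures in `R`: the initial data
structure (the output of the rule on the empty input), the value of a query on a data structure,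
and the update of a data structure by a query and an approximate answer to it. -/
structure UpdateRule (X R : Type*) where
  init : R
  eval : LinearQuery X → R → ℝ
  update : R → LinearQuery X → ℝ → R

/-- The noise scale `σ` of the online query release mechanism. -/
noncomputable def noiseScale (B ε δ : ℝ) : ℝ :=
  1000 * √B * Real.log (4 / δ) / ε

/-- The threshold `T` of the online query release mechanism. -/
noncomputable def updateThreshold (B ε δ β : ℝ) (k : ℕ) : ℝ :=
  4 * noiseScale B ε δ * Real.log (2 * k / β)

/-- The joint state of the mechanism and the adversary between two rounds. -/
structure RunState (X R : Type*) (t : ℕ) where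
  /-- the transcript so far -/
  transcript : Transcript X t
  /-- the current data structure of the mechanism -/
  current : R
  /-- the number `C` of updates made so far -/
  updates : ℕ

/-- One round of the online query release mechanism with update rule `U`, update budget `B` and
threshold `T` on the database `D`: `s` is the state before the round, `Q` the query received, and
`z` the noise. Once the number of updates has reached `B` the mechanism has terminated. -/
noncomputable def mechanismRound {X R : Type*} [Fintype X] (U : UpdateRule X R) (B T : ℝ)
    (D : Database X) {t : ℕ} (s : RunState X R t) (Q : LinearQuery X) (z : ℝ) :
    RunState X R (t + 1) :=
  let noisy := Q.onDatabase D + z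
  let guess := U.eval Q s.current
  if B ≤ (s.updates : ℝ) then
    ⟨Fin.snoc s.transcript (Q, Sum.inr ()), s.current, s.updates⟩
  else if |noisy - guess| ≤ T then
    ⟨Fin.snoc s.transcript (Q, Sum.inl guess), s.current, s.updates⟩
  else
    ⟨Fin.snoc s.transcript (Q, Sum.inl noisy), U.update s.current Q noisy, s.updates + 1⟩

/-- The first `t` rounds of the mechanism on the database `D`, against the adversary `A` with
coins `ω`; `z i` is the noise of round `i`. -/
noncomputable def runMechanism {X R Ω : Type*} [Fintype X] [MeasurableSpace Ω]
    (U : UpdateRule X R) (B T : ℝ) (A : Adversary X Ω) (D : Database X) (ω : Ω) :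
    (t : ℕ) → (Fin t → ℝ) → RunState X R t
  | 0, _ => ⟨Fin.elim0, U.init, 0⟩
  | t + 1, z =>
    let s := runMechanism U B T A D ω t (Fin.init z)
    mechanismRound U B T D s (A.query t (ω, s.transcript)) (z (Fin.last t))

/-- The law of all coins in an interaction of `k` rounds: the adversary's coins, with law `ν`, and
`k` independent Laplace variables. -/
noncomputable def coinLaw {Ω : Type*} [MeasurableSpace Ω] (ν : Measure Ω) (k : ℕ) (σ : ℝ) :
    Measure (Ω × (Fin k → ℝ)) :=
  ν.prod (Measure.pi fun _ => laplace σ)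

/-- The view of the adversary in an interaction of `k` rounds: its coins and the transcript. -/
noncomputable def view {X R Ω : Type*} [Fintype X] [MeasurableSpace Ω]
    (U : UpdateRule X R) (B T : ℝ) (k : ℕ) (A : Adversary X Ω) (D : Database X)
    (c : Ω × (Fin k → ℝ)) : Ω × Transcript X k :=
  (c.1, (runMechanism U B T A D c.1 k c.2).transcript)

/-- Every query of the transcript has been answered, with error at most `a`. -/
def Transcript.AccurateFor {X : Type*} [Fintype X] {k : ℕ} (τ : Transcript X k)
    (D : Database X) (a : ℝ) : Prop :=
  ∀ i : Fin k, ∃ r : ℝ, (τ i).2 = Sum.inl r ∧ |(τ i).1.onDatabase D - r| ≤ a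

/-- The online query release mechanism for `k` queries, with update rule `U` and update budget `B`,
is `(ε, δ)`-differentially private: against every adversary, the adversary's view is. -/
def ReleaseIsPrivate {X : Type u} {R : Type w} [Fintype X]
    (U : UpdateRule X R) (B ε δ β : ℝ) (k : ℕ) : Prop :=
  ∀ (Ω : Type v) [MeasurableSpace Ω] (ν : Measure Ω) [IsProbabilityMeasure ν]
    (A : Adversary X Ω),
    IsDifferentiallyPrivate (coinLaw ν k (noiseScale B ε δ))
      (view U B (updateThreshold B ε δ β k) k A) ε δ

/-- The same mechanism is `(a, β)`-accurate on databases of size `n`: on each of them and against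
every adversary, with probability at least `1 - β` all `k` queries are answered up to error `a`. -/
def ReleaseIsAccurate {X : Type u} {R : Type w} [Fintype X]
    (U : UpdateRule X R) (B ε δ β : ℝ) (k n : ℕ) (a : ℝ) : Prop :=
  ∀ (Ω : Type v) [MeasurableSpace Ω] (ν : Measure Ω) [IsProbabilityMeasure ν]
    (A : Adversary X Ω) (D : Database X), D.size = n →
    ENNReal.ofReal (1 - β) ≤ coinLaw ν k (noiseScale B ε δ)
      {c | (view U B (updateThreshold B ε δ β k) k A D c).2.AccurateFor D a}

/-! ### Multiplicative weights -/

/-- The penalty `r`: the query `Q` if the hypothesis overestimates, and `1 - Q` otherwise. -/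
noncomputable def mwPenalty {X : Type*} (Q : LinearQuery X) (noisy guess : ℝ) (x : X) : ℝ :=
  if noisy < guess then (Q x : ℝ) else 1 - (Q x : ℝ)

/-- The multiplicative weights rule with parameter `α` for databases of size `n`. The hypotheses
are probability vectors, and a query takes on `p` the value `n * (Q ⬝ p)`. -/
noncomputable def mwRule (X : Type*) [Fintype X] (n : ℕ) (α : ℝ) : UpdateRule X (X → ℝ) where
  init := fun _ => 1 / (Fintype.card X : ℝ)
  eval := fun Q p => n * Q.dot p
  update := fun p Q noisy =>
    let η := α / (2 * n)
    let w : X → ℝ := fun x => Real.exp (-η * mwPenalty Q noisy (n * Q.dot p) x) * p x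
    fun x => w x / ∑ y, w y

/-- The update budget of multiplicative weights. -/
noncomputable def mwBudget (X : Type*) [Fintype X] (n : ℕ) (α : ℝ) : ℝ :=
  4 * (n : ℝ) ^ 2 * Real.log (Fintype.card X) / α ^ 2

/-! ### The median mechanism -/

open Classical in
/-- The median of the values `f i`, `i ∈ s`, with multiplicity: the midpoint between the least `v`
such that at least half of the values are `≤ v` and the greatest `v` such that at least half of
the values are `≥ v`. -/
noncomputable def median {ι : Type*} (s : Finset ι) (f : ι → ℝ) : ℝ :=
  (sInf {v : ℝ | s.card ≤ 2 * (s.filter fun i => f i ≤ v).card} +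
    sSup {v : ℝ | s.card ≤ 2 * (s.filter fun i => v ≤ f i).card}) / 2

/-- The size `n² log k / α²`, rounded up, of the databases in a median data structure. -/
noncomputable def medianDbSize (n k : ℕ) (α : ℝ) : ℕ :=
  ⌈(n : ℝ) ^ 2 * Real.log k / α ^ 2⌉₊

/-- The value of a query on a database, rescaled from the size of that database to size `n`. -/
noncomputable def LinearQuery.rescaled {X : Type*} [Fintype X] (n : ℕ) (Q : LinearQuery X)
    (E : Database X) : ℝ :=
  n * (Q.onDatabase E / E.size)

open Classical in
/-- The median rule with parameters `k`, `α` for databases of size `n`. Its data structures are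
finite collections of databases, initially all those of size `medianDbSize n k α`. -/
noncomputable def medianRule (X : Type*) [Fintype X] (n k : ℕ) (α : ℝ) :
    UpdateRule X (Finset (Database X)) where
  init := Finset.piAntidiag Finset.univ (medianDbSize n k α)
  eval := fun Q S => median S (LinearQuery.rescaled n Q)
  update := fun S Q noisy =>
    let m := median S (LinearQuery.rescaled n Q)
    if S = ∅ then Finset.piAntidiag Finset.univ (medianDbSize n k α)
    else if noisy < m then S.filter fun E => ¬ m ≤ Q.rescaled n E
    else if m < noisy then S.filter fun E => ¬ Q.rescaled n E ≤ m
    else S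

/-- The update budget of the median mechanism, `(n² log k / α²) log |X|`. The first factor is the
size of the databases, a natural number. An update at least halves the collection, which has at
most `|X|` to that power members at first; so the second logarithm is binary. -/
noncomputable def medianBudget (X : Type*) [Fintype X] (n k : ℕ) (α : ℝ) : ℝ :=
  medianDbSize n k α * Real.logb 2 (Fintype.card X)

/-! Both mechanisms are instances of one argument for a general update rule, followed by a choice of
`α`.

Privacy. A round without update outputs the guess, which the past already determines, so only the
event "no update" is revealed. Averaging the density ratio of the two Laplace laws over that event
leaves a ratio whose mean is one and whose `a`-th moment exceeds one by at most a multiple of the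
probability of an update. A factor `e^{-θ}` charged to each update absorbs this excess
(`lintegral_discounted_rpow_le`). Induction over the rounds (`lintegral_runMechanism_le`) gives a
Rényi-type comparison of the two runs whose loss is `θ` times the number of updates. That number is
at most `B + 1`, whatever `k` is. With `a = 1 + log(4/δ)/ε` the noise scale makes the total loss at
most `1/a`, and `le_exp_mul_add_of_le_rpow` turns the comparison into `(ε, δ)`-privacy.

Accuracy. With probability at least `1 - β/2` every noise is at most `T/4`. Then a guess that is
kept has error at most `5T/4`, and an update certifies that the guess was off by more than `3T/4`,
in a known direction. Such updates are fewer than `B`. For multiplicative weights each one lowers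
the cross entropy relative to the database by a fixed amount (`mwInvariant_accuracy`). For the
median each one at least halves the collection and never removes a small sample of the database that
is accurate on all queries asked (`medianInvariant_accuracy`).

Parameters. Since `√B` scales like `1/α`, the threshold `T` is, up to a factor 2, `W/α` with `W`
free of `α`. The argument needs `α` at most a multiple of `T`, and the error is of order `T`, so `α`
is taken of order `√W`, which is the claimed bound. It is capped at order `n` (up to `√(log|X|)`) to
keep the budget at least one. When the cap is active, `n` is below the threshold, no update occurs,
and the error `n` is small enough. -/

/-! ### The Laplace distribution -/

/-- The Laplace distribution with scale `σ`, centred at `q`. -/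
noncomputable def laplaceAt (σ q : ℝ) : Measure ℝ :=
  volume.withDensity (fun y => ENNReal.ofReal (1 / (2 * σ) * Real.exp (-|y - q| / σ)))

lemma lintegral_laplace_add (σ q : ℝ) {F : ℝ → ENNReal} (hF : Measurable F) :
    ∫⁻ z, F (q + z) ∂laplace σ = ∫⁻ y, F y ∂laplaceAt σ q := by
  unfold laplace laplaceAt
  rw [lintegral_withDensity_eq_lintegral_mul _ (by fun_prop) (by fun_prop),
    lintegral_withDensity_eq_lintegral_mul _ (by fun_prop) hF,
    ← lintegral_add_left_eq_self
      ((fun y => ENNReal.ofReal (1 / (2 * σ) * Real.exp (-|y - q| / σ))) * F) q]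
  simp

/-- The density of the Laplace distribution at `q` with respect to the one at `q'`. -/
noncomputable def laplaceRatio (σ q q' y : ℝ) : ℝ := Real.exp ((|y - q'| - |y - q|) / σ)

lemma measurable_laplaceRatio (σ q q' : ℝ) : Measurable (laplaceRatio σ q q') := by
  unfold laplaceRatio; fun_prop

lemma lintegral_laplaceAt_eq (σ q q' : ℝ) (hσ : 0 < σ) {F : ℝ → ENNReal} (hF : Measurable F) :
    ∫⁻ y, F y ∂laplaceAt σ q =
      ∫⁻ y, F y * ENNReal.ofReal (laplaceRatio σ q q' y) ∂laplaceAt σ q' := by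
  have hr := measurable_laplaceRatio σ q q'
  unfold laplaceAt
  rw [lintegral_withDensity_eq_lintegral_mul _ (by fun_prop) hF,
    lintegral_withDensity_eq_lintegral_mul _ (by fun_prop) (by fun_prop)]
  refine lintegral_congr fun y => ?_
  simp only [Pi.mul_apply]
  rw [mul_comm (F y), ← mul_assoc, ← ENNReal.ofReal_mul (by positivity)]
  congr 2
  rw [laplaceRatio, mul_assoc, ← Real.exp_add]
  congr 2
  ring

lemma laplaceRatio_le {σ q q' : ℝ} (hσ : 0 < σ) (hq : |q - q'| ≤ 1) (y : ℝ) :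
    laplaceRatio σ q q' y ≤ Real.exp (1 / σ) := by
  refine Real.exp_le_exp.2 (div_le_div_of_nonneg_right ?_ hσ.le)
  have := abs_sub_abs_le_abs_sub (y - q') (y - q)
  rw [show y - q' - (y - q) = q - q' by ring] at this
  linarith

lemma le_laplaceRatio {σ q q' : ℝ} (hσ : 0 < σ) (hq : |q - q'| ≤ 1) (y : ℝ) :
    Real.exp (-(1 / σ)) ≤ laplaceRatio σ q q' y := by
  refine Real.exp_le_exp.2 ?_
  rw [← neg_div]
  refine div_le_div_of_nonneg_right ?_ hσ.le
  have := abs_sub_abs_le_abs_sub (y - q) (y - q')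
  rw [show y - q - (y - q') = -(q - q') by ring, abs_neg] at this
  linarith

lemma integrable_exp_neg_abs_div {σ : ℝ} (hσ : 0 < σ) :
    Integrable (fun x : ℝ => 1 / (2 * σ) * Real.exp (-|x| / σ)) := by
  have h : IntegrableOn (fun x : ℝ => 1 / (2 * σ) * Real.exp (-(1 / σ) * x)) (Set.Ioi 0) :=
    (exp_neg_integrableOn_Ioi 0 (b := 1 / σ) (by positivity)).const_mul (1 / (2 * σ))
  have h1 : IntegrableOn (fun x : ℝ => 1 / (2 * σ) * Real.exp (-|x| / σ)) (Set.Ioi 0) := by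
    refine IntegrableOn.congr_fun h (fun x hx => ?_) measurableSet_Ioi
    rw [abs_of_pos hx]
    ring_nf
  have h2 : IntegrableOn (fun x : ℝ => 1 / (2 * σ) * Real.exp (-|x| / σ)) (Set.Iic 0) := by
    have h3 := Iff.mpr integrableOn_Ici_iff_integrableOn_Ioi h1
    rw [← neg_zero] at h3
    simpa using MeasureTheory.IntegrableOn.comp_neg_Iic h3
  rw [← integrableOn_univ, ← Set.Iic_union_Ioi (a := (0 : ℝ))]
  exact h2.union h1

lemma laplace_lt_abs {σ t : ℝ} (hσ : 0 < σ) (ht : 0 ≤ t) :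
    laplace σ {x | t < |x|} = ENNReal.ofReal (Real.exp (-t / σ)) := by
  have hm : MeasurableSet {x : ℝ | t < |x|} := measurableSet_lt measurable_const (by fun_prop)
  rw [laplace, withDensity_apply _ hm,
    ← ofReal_integral_eq_lintegral_ofReal (integrable_exp_neg_abs_div hσ).integrableOn
      (ae_of_all _ fun x => by positivity), ← integral_indicator hm]
  congr 1
  have h1 : (Set.indicator {x : ℝ | t < |x|} fun x => 1 / (2 * σ) * Real.exp (-|x| / σ)) =
      fun x => (Set.Ioi t).indicator (fun x => 1 / (2 * σ) * Real.exp (-x / σ)) |x| := by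
    ext x
    simp [Set.indicator]
  rw [h1, integral_comp_abs, setIntegral_indicator measurableSet_Ioi,
    Set.inter_eq_right.2 (Set.Ioi_subset_Ioi ht), integral_const_mul]
  have h2 : ∫ x in Set.Ioi t, Real.exp (-x / σ) = σ * Real.exp (-t / σ) := by
    have := integral_exp_mul_Ioi (a := -(1 / σ)) (by simpa using hσ) t
    rw [show (fun x : ℝ => Real.exp (-x / σ)) = fun x => Real.exp (-(1 / σ) * x) by
      ext x; congr 1; ring, this, show -(1 / σ) * t = -t / σ by ring]
    field_simp
  rw [h2]
  field_simp

lemma isProbabilityMeasure_laplace {σ : ℝ} (hσ : 0 < σ) : IsProbabilityMeasure (laplace σ) := by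
  constructor
  have h := laplace_lt_abs hσ le_rfl
  have h0 : ({x : ℝ | 0 < |x|} : Set ℝ) =ᵐ[laplace σ] Set.univ := by
    rw [ae_eq_univ]
    have : {x : ℝ | 0 < |x|}ᶜ = {0} := by ext; simp
    rw [this]
    exact (withDensity_absolutelyContinuous volume _) (by simp)
  rw [← measure_congr h0, h]
  simp

lemma isProbabilityMeasure_laplaceAt {σ : ℝ} (hσ : 0 < σ) (q : ℝ) :
    IsProbabilityMeasure (laplaceAt σ q) := by
  have := isProbabilityMeasure_laplace hσ
  constructor
  have h := lintegral_laplace_add σ q (F := fun _ => 1) measurable_const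
  simpa using h.symm

/-! ### A one-round Rényi estimate -/

lemma exp_le_one_add_add_sq {x : ℝ} (hx : |x| ≤ 1) : Real.exp x ≤ 1 + x + x ^ 2 := by
  have := Real.abs_exp_sub_one_sub_id_le hx
  linarith [abs_le.1 this]

lemma exp_neg_le_quadratic {t : ℝ} (ht : 0 ≤ t) : Real.exp (-t) ≤ 1 - t + t ^ 2 / 2 := by
  have h := Real.quadratic_le_exp_of_nonneg ht
  rw [Real.exp_neg, inv_le_iff_one_le_mul₀ (Real.exp_pos t)]
  have h1 : 0 ≤ 1 - t + t ^ 2 / 2 := by nlinarith [sq_nonneg (t - 1)]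
  nlinarith [mul_le_mul_of_nonneg_left h h1, sq_nonneg (t ^ 2)]

/-- From `x ≤ e^{x-1}`, hence `x^a ≤ e^{a(x-1)}`. The linear term is kept exact so that it can
cancel after integration. -/
lemma rpow_le_quadratic {a x : ℝ} (ha : 0 ≤ a) (hx : 0 ≤ x) (hax : a * |x - 1| ≤ 1) :
    x ^ a ≤ 1 + a * (x - 1) + a ^ 2 * (x - 1) ^ 2 := by
  have h1 : x ^ a ≤ Real.exp (a * (x - 1)) := by
    rw [mul_comm, Real.exp_mul]
    exact Real.rpow_le_rpow hx (by linarith [Real.add_one_le_exp (x - 1)]) ha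
  refine h1.trans ((exp_le_one_add_add_sq ?_).trans (by rw [mul_pow]))
  rwa [abs_mul, abs_of_nonneg ha]

/-- A density `r` with values in `[e^{-s}, e^s]`, replaced by its conditional expectation off `U`
and discounted by `e^{-θ}` on `U`, has `a`-th moment at most one. -/
lemma lintegral_discounted_rpow_le {Y : Type*} [MeasurableSpace Y] {μ : Measure Y}
    [IsProbabilityMeasure μ] {r : Y → ℝ} (hr : Measurable r) {s a θ : ℝ} (hs : 0 ≤ s)
    (hlo : ∀ y, Real.exp (-s) ≤ r y) (hup : ∀ y, r y ≤ Real.exp s) (hr1 : ∫ y, r y ∂μ = 1)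
    {U : Set Y} (hU : MeasurableSet U) [DecidablePred (· ∈ U)] (ha : 1 < a)
    (has : a * (Real.exp s - 1) ≤ 1 / 4)
    (hθ : a * θ = 8 * (a * (Real.exp s - 1)) ^ 2) :
    ∫⁻ y, ENNReal.ofReal (if y ∈ U then r y * Real.exp (-θ)
      else (∫ y in Uᶜ, r y ∂μ) / μ.real Uᶜ) ^ a ∂μ ≤ 1 := by
  have ha0 : 0 < a := by linarith
  set e := Real.exp s - 1 with he
  have he0 : 0 ≤ e := by linarith [Real.add_one_le_exp s]
  have hse : s ≤ e := by linarith [Real.add_one_le_exp s]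
  have hlo' : ∀ y, 1 - e ≤ r y := fun y => by
    refine le_trans ?_ (hlo y)
    linarith [Real.add_one_le_exp (-s)]
  have hup' : ∀ y, r y ≤ 1 + e := fun y => by linarith [hup y]
  have hr0 : ∀ y, 0 ≤ r y := fun y => (Real.exp_pos _).le.trans (hlo y)
  have habs : ∀ y, |r y - 1| ≤ e := fun y => abs_le.2 ⟨by linarith [hlo' y], by linarith [hup' y]⟩
  have hint : Integrable r μ := Integrable.of_bound hr.aestronglyMeasurable (1 + e)
    (ae_of_all _ fun y => by rw [Real.norm_of_nonneg (hr0 y)]; exact hup' y)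
  have hinta : Integrable (fun y => r y ^ a) μ :=
    Integrable.of_bound (hr.pow_const a).aestronglyMeasurable ((1 + e) ^ a)
    (ae_of_all _ fun y => by
      rw [Real.norm_of_nonneg (Real.rpow_nonneg (hr0 y) a)]
      exact Real.rpow_le_rpow (hr0 y) (hup' y) ha0.le)
  set u' := μ.real U with hu'
  set v' := μ.real Uᶜ with hv'
  set m := ∫ y in U, r y ∂μ with hm
  set c := ∫ y in Uᶜ, r y ∂μ with hc
  have huv : u' + v' = 1 := by simpa using measureReal_add_measureReal_compl (μ := μ) hU
  have hmc : m + c = 1 := by rw [← hr1]; exact integral_add_compl hU hint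
  have hu0 : 0 ≤ u' := measureReal_nonneg
  have hv0 : 0 ≤ v' := measureReal_nonneg
  have hc0 : 0 ≤ c := integral_nonneg fun y => hr0 y
  have hlin : ∀ b : ℝ, ∀ V : Set Y, ∫ _ in V, b ∂μ = b * μ.real V := fun b V => by
    simp [mul_comm]
  have bnd : ∀ V : Set Y, MeasurableSet V → |(∫ y in V, r y ∂μ) - μ.real V| ≤ e * μ.real V := by
    intro V hV
    have h1 : (1 - e) * μ.real V ≤ ∫ y in V, r y ∂μ := by
      rw [← hlin]
      exact setIntegral_mono (by simp) hint.integrableOn hlo'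
    have h2 : ∫ y in V, r y ∂μ ≤ (1 + e) * μ.real V := by
      rw [← hlin]
      exact setIntegral_mono hint.integrableOn (by simp) hup'
    exact abs_le.2 ⟨by linarith, by linarith⟩
  have hcv := bnd _ hU.compl
  have hmu := bnd _ hU
  rw [← hm, ← hu'] at hmu
  rw [← hc, ← hv'] at hcv
  set κ := (a * e) ^ 2 with hκ
  set ρ := c / v' with hρ
  have hρ0 : 0 ≤ ρ := by positivity
  have hR1up : ∫ y in U, r y ^ a ∂μ ≤ u' + a * (m - u') + κ * u' := by
    have h1 : ∫ y in U, r y ^ a ∂μ ≤ ∫ y in U, (a * r y + (1 - a + κ)) ∂μ := by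
      refine setIntegral_mono hinta.integrableOn
        ((hint.const_mul a).add (integrable_const _)).integrableOn fun y => ?_
      have h2 := rpow_le_quadratic ha0.le (hr0 y)
        ((mul_le_mul_of_nonneg_left (habs y) ha0.le).trans (by linarith))
      have h3 : (r y - 1) ^ 2 ≤ e ^ 2 := sq_le_sq' (by linarith [hlo' y]) (by linarith [hup' y])
      have h4 := mul_le_mul_of_nonneg_left h3 (sq_nonneg a)
      simp only [hκ, mul_pow]
      linarith
    rw [integral_add (hint.const_mul a).integrableOn (integrable_const _), integral_const_mul,
      hlin] at h1
    linarith
  -- Here `r^a ≥ e^{-as} ≥ 1 - as ≥ 3/4`; this is the mass on which the discount acts.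
  have hR1lo : u' / 2 ≤ ∫ y in U, r y ^ a ∂μ := by
    have h1 : (1 / 2) * u' ≤ ∫ y in U, r y ^ a ∂μ := by
      rw [← hlin]
      refine setIntegral_mono (by simp) hinta.integrableOn fun y => ?_
      have h2 : Real.exp (-s) ^ a ≤ r y ^ a :=
        Real.rpow_le_rpow (Real.exp_pos _).le (hlo y) ha0.le
      rw [← Real.exp_mul] at h2
      have h3 := Real.add_one_le_exp (-s * a)
      have h4 : a * s ≤ a * e := mul_le_mul_of_nonneg_left hse ha0.le
      simp only
      nlinarith
    linarith
  -- The second-order term is bounded by `u'`, not `v'`: since `m + c = u' + v'`, the deviation `c -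
  -- v'` equals `-(m - u')`, which is at most `e * u'` in absolute value.
  have hR0 : v' * ρ ^ a ≤ v' + a * (c - v') + κ * u' := by
    rcases hv0.eq_or_lt with h | h
    · rw [← h] at hcv ⊢
      have : c = 0 := by simpa using hcv
      rw [this]
      have : 0 ≤ κ * u' := by positivity
      simpa
    · have hρ1 : ρ - 1 = (c - v') / v' := by rw [hρ]; field_simp
      have h1 : |ρ - 1| ≤ e := by
        rw [hρ1, abs_div, abs_of_pos h, div_le_iff₀ h]; exact hcv
      have h2 := rpow_le_quadratic ha0.le hρ0
        ((mul_le_mul_of_nonneg_left h1 ha0.le).trans (by linarith))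
      have h3 : v' * (ρ - 1) ^ 2 ≤ e ^ 2 * u' := by
        have h5 : v' * |ρ - 1| ≤ e * u' := by
          rw [hρ1, abs_div, abs_of_pos h, mul_div_cancel₀ _ h.ne']
          rwa [show c - v' = -(m - u') by linarith, abs_neg]
        rw [← sq_abs, sq, ← mul_assoc]
        calc v' * |ρ - 1| * |ρ - 1| ≤ e * u' * e := mul_le_mul h5 h1 (abs_nonneg _) (by positivity)
          _ = _ := by ring
      have h4 := mul_le_mul_of_nonneg_left h2 hv0
      have h6 : v' * (ρ - 1) = c - v' := by rw [hρ1]; field_simp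
      have h7 := mul_le_mul_of_nonneg_left h3 (sq_nonneg a)
      simp only [hκ, mul_pow]
      calc v' * ρ ^ a ≤ v' * (1 + a * (ρ - 1) + a ^ 2 * (ρ - 1) ^ 2) := h4
        _ = v' + a * (v' * (ρ - 1)) + a ^ 2 * (v' * (ρ - 1) ^ 2) := by ring
        _ ≤ _ := by rw [h6]; linarith
  have hΘ : Real.exp (-(a * θ)) ≤ 1 - 4 * κ := by
    have hκ1 : κ ≤ 1 / 16 := by
      have : (a * e) ^ 2 ≤ (1 / 4) ^ 2 := pow_le_pow_left₀ (by positivity) has 2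
      rw [hκ]; linarith
    have hκ0 : 0 ≤ κ := sq_nonneg _
    have := exp_neg_le_quadratic (t := a * θ) (by rw [hθ]; positivity)
    rw [hθ] at this ⊢
    nlinarith
  -- The linear terms cancel, the quadratic ones add up to at most `2κu'`, and the discount removes
  -- at least `4κ · u'/2`.
  have key : Real.exp (-(a * θ)) * (∫ y in U, r y ^ a ∂μ) + v' * ρ ^ a ≤ 1 := by
    have h1 : 0 ≤ ∫ y in U, r y ^ a ∂μ := by linarith
    have h2 := mul_le_mul_of_nonneg_right hΘ h1
    have h3 : 0 ≤ κ := sq_nonneg _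
    have h4 := mul_le_mul_of_nonneg_left hR1lo h3
    have h5 : m - u' = - (c - v') := by linarith
    rw [h5] at hR1up
    nlinarith
  rw [← lintegral_add_compl _ hU]
  have e1 : ∫⁻ y in U, ENNReal.ofReal (if y ∈ U then r y * Real.exp (-θ) else ρ) ^ a ∂μ =
      ENNReal.ofReal (Real.exp (-(a * θ)) * ∫ y in U, r y ^ a ∂μ) := by
    rw [← integral_const_mul, ofReal_integral_eq_lintegral_ofReal
      (hinta.const_mul _).integrableOn (ae_of_all _ fun y =>
        mul_nonneg (Real.exp_pos _).le (Real.rpow_nonneg (hr0 y) a))]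
    refine setLIntegral_congr_fun hU fun y hy => ?_
    simp only [hy, if_true]
    rw [ENNReal.ofReal_rpow_of_nonneg (mul_nonneg (hr0 y) (Real.exp_pos _).le) ha0.le,
      Real.mul_rpow (hr0 y) (Real.exp_pos _).le, ← Real.exp_mul, mul_comm]
    congr 3
    ring
  have e2 : ∫⁻ y in Uᶜ, ENNReal.ofReal (if y ∈ U then r y * Real.exp (-θ) else ρ) ^ a ∂μ =
      ENNReal.ofReal (v' * ρ ^ a) := by
    rw [setLIntegral_congr_fun hU.compl (g := fun _ => ENNReal.ofReal (ρ ^ a)), setLIntegral_const,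
      mul_comm, ENNReal.ofReal_mul hv0, hv', ofReal_measureReal]
    intro y hy
    have hy' : y ∉ U := hy
    simp only [hy', if_false]
    rw [ENNReal.ofReal_rpow_of_nonneg hρ0 ha0.le]
  rw [e1, e2, ← ENNReal.ofReal_add
    (mul_nonneg (Real.exp_pos _).le (by linarith)) (by positivity)]
  exact ENNReal.ofReal_le_one.2 key

/-- As `G` is constant off `U`, replacing `r` there by its average does not change the integral.
Hölder's inequality then separates `G` from the modified density, whose `a`-norm is at most one. -/
lemma lintegral_discounted_le {Y : Type*} [MeasurableSpace Y] {μ : Measure Y}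
    [IsProbabilityMeasure μ] {r : Y → ℝ} (hr : Measurable r) {s a p θ : ℝ} (hs : 0 ≤ s)
    (hlo : ∀ y, Real.exp (-s) ≤ r y) (hup : ∀ y, r y ≤ Real.exp s) (hr1 : ∫ y, r y ∂μ = 1)
    {U : Set Y} (hU : MeasurableSet U) [DecidablePred (· ∈ U)] (hpa : p.HolderConjugate a)
    (has : a * (Real.exp s - 1) ≤ 1 / 4)
    (hθ : a * θ = 8 * (a * (Real.exp s - 1)) ^ 2)
    {G : Y → ENNReal} (hG : Measurable G) {g : ENNReal} (hGU : ∀ y, y ∉ U → G y = g) :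
    ∫⁻ y, (if y ∈ U then G y * ENNReal.ofReal (Real.exp (-θ)) else G y) *
      ENNReal.ofReal (r y) ∂μ ≤ (∫⁻ y, G y ^ p ∂μ) ^ (1 / p) := by
  have hr0 : ∀ y, 0 ≤ r y := fun y => (Real.exp_pos _).le.trans (hlo y)
  have hint : Integrable r μ := Integrable.of_bound hr.aestronglyMeasurable (Real.exp s)
    (ae_of_all _ fun y => by rw [Real.norm_of_nonneg (hr0 y)]; exact hup y)
  set ρ := (∫ y in Uᶜ, r y ∂μ) / μ.real Uᶜ with hρ
  set f : Y → ENNReal := fun y => ENNReal.ofReal (if y ∈ U then r y * Real.exp (-θ) else ρ) with hf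
  have hfm : Measurable f :=
    (Measurable.ite hU (hr.mul_const _) measurable_const).ennreal_ofReal
  have h1 : ∫⁻ y, (if y ∈ U then G y * ENNReal.ofReal (Real.exp (-θ)) else G y) *
      ENNReal.ofReal (r y) ∂μ = ∫⁻ y, (G * f) y ∂μ := by
    rw [← lintegral_add_compl _ hU, ← lintegral_add_compl (fun y => (G * f) y) hU]
    congr 1
    · refine setLIntegral_congr_fun hU fun y hy => ?_
      simp only [hy, if_true, hf, Pi.mul_apply]
      rw [mul_comm (r y), ENNReal.ofReal_mul (Real.exp_pos _).le, mul_assoc]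
    · rw [setLIntegral_congr_fun hU.compl (g := fun y => g * ENNReal.ofReal (r y)),
        setLIntegral_congr_fun hU.compl (f := fun y => (G * f) y)
          (g := fun y => g * ENNReal.ofReal ρ),
        lintegral_const_mul _ hr.ennreal_ofReal, setLIntegral_const, mul_assoc,
        ← ofReal_integral_eq_lintegral_ofReal hint.integrableOn (ae_of_all _ hr0)]
      · congr 1
        rcases eq_or_ne (μ Uᶜ) 0 with h | h
        · rw [h, Measure.restrict_eq_zero.2 h]; simp
        · have h0 : μ.real Uᶜ ≠ 0 := by
            rw [measureReal_def]; exact ENNReal.toReal_ne_zero.2 ⟨h, measure_ne_top _ _⟩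
          rw [← ofReal_measureReal (μ := μ) (s := Uᶜ), ← ENNReal.ofReal_mul'
            measureReal_nonneg, hρ, div_mul_cancel₀ _ h0]
      · intro y hy
        have hy' : y ∉ U := hy
        simp [hy', hf, hGU y hy']
      · intro y hy
        have hy' : y ∉ U := hy
        simp [hy', hGU y hy']
  rw [h1]
  refine (ENNReal.lintegral_mul_le_Lp_mul_Lq μ hpa hG.aemeasurable hfm.aemeasurable).trans ?_
  refine mul_le_of_le_one_right' ?_
  exact ENNReal.rpow_le_one
    (lintegral_discounted_rpow_le hr hs hlo hup hr1 hU hpa.symm.lt has hθ)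
    (by have := hpa.symm.pos; positivity)

/-! ### Measurability of the mechanism -/

instance RunState.instMeasurableSpace {X R : Type*} [MeasurableSpace R] {t : ℕ} :
    MeasurableSpace (RunState X R t) :=
  MeasurableSpace.comap (fun s => (s.transcript, s.current, s.updates)) inferInstance

section RunStateMeasurability

variable {X R Z : Type*} [MeasurableSpace R] [MeasurableSpace Z] {t : ℕ}

lemma RunState.measurable_toProd :
    Measurable (fun s : RunState X R t => (s.transcript, s.current, s.updates)) :=
  comap_measurable _

lemma RunState.measurable_transcript :
    Measurable (fun s : RunState X R t => s.transcript) :=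
  measurable_fst.comp RunState.measurable_toProd

lemma RunState.measurable_current :
    Measurable (fun s : RunState X R t => s.current) :=
  (measurable_fst.comp measurable_snd).comp RunState.measurable_toProd

lemma RunState.measurable_updates :
    Measurable (fun s : RunState X R t => s.updates) :=
  (measurable_snd.comp measurable_snd).comp RunState.measurable_toProd

lemma RunState.measurable_mk {f : Z → Transcript X t} {g : Z → R} {c : Z → ℕ}
    (hf : Measurable f) (hg : Measurable g) (hc : Measurable c) :
    Measurable (fun z => (⟨f z, g z, c z⟩ : RunState X R t)) :=
  measurable_comap_iff.2 (hf.prodMk (hg.prodMk hc))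

lemma measurable_transcript_snoc {f : Z → Transcript X t} {g : Z → LinearQuery X × Answer}
    (hf : Measurable f) (hg : Measurable g) :
    Measurable (fun z => (Fin.snoc (f z) (g z) : Transcript X (t + 1))) := by
  refine measurable_pi_iff.2 fun i => ?_
  induction i using Fin.lastCases with
  | last => simpa using hg
  | cast i => simpa using measurable_pi_iff.1 hf i

end RunStateMeasurability

/-- The evaluation and the update map of the rule are measurable. -/
structure UpdateRule.IsMeasurable {X R : Type*} [MeasurableSpace R] (U : UpdateRule X R) :
    Prop where
  measurable_eval : Measurable fun p : LinearQuery X × R => U.eval p.1 p.2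
  measurable_update : Measurable fun p : R × LinearQuery X × ℝ => U.update p.1 p.2.1 p.2.2

/-- One round of the mechanism, as a function of the noisy answer to the query. -/
noncomputable def noisyRound {X R : Type*} (U : UpdateRule X R) (B T : ℝ)
    {t : ℕ} (s : RunState X R t) (Q : LinearQuery X) (noisy : ℝ) : RunState X R (t + 1) :=
  if B ≤ (s.updates : ℝ) then
    ⟨Fin.snoc s.transcript (Q, Sum.inr ()), s.current, s.updates⟩
  else if |noisy - U.eval Q s.current| ≤ T then
    ⟨Fin.snoc s.transcript (Q, Sum.inl (U.eval Q s.current)), s.current, s.updates⟩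
  else
    ⟨Fin.snoc s.transcript (Q, Sum.inl noisy), U.update s.current Q noisy, s.updates + 1⟩

lemma mechanismRound_eq {X R : Type*} [Fintype X] (U : UpdateRule X R) (B T : ℝ)
    (D : Database X) {t : ℕ} (s : RunState X R t) (Q : LinearQuery X) (z : ℝ) :
    mechanismRound U B T D s Q z = noisyRound U B T s Q (Q.onDatabase D + z) := rfl

lemma measurable_noisyRound {X R : Type*} [MeasurableSpace R] {U : UpdateRule X R}
    (hU : U.IsMeasurable) (B T : ℝ) (t : ℕ) :
    Measurable fun p : RunState X R t × LinearQuery X × ℝ =>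
      noisyRound U B T p.1 p.2.1 p.2.2 := by
  have hs : Measurable fun p : RunState X R t × LinearQuery X × ℝ => p.1 := measurable_fst
  have hQ : Measurable fun p : RunState X R t × LinearQuery X × ℝ => p.2.1 := by fun_prop
  have hy : Measurable fun p : RunState X R t × LinearQuery X × ℝ => p.2.2 := by fun_prop
  have htr := RunState.measurable_transcript.comp hs
  have hcu := RunState.measurable_current.comp hs
  have hup := RunState.measurable_updates.comp hs
  have hev := hU.measurable_eval.comp (hQ.prodMk hcu)
  have hud := hU.measurable_update.comp (hcu.prodMk (hQ.prodMk hy))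
  unfold noisyRound
  refine Measurable.ite (measurableSet_le measurable_const
    ((measurable_of_countable (fun n : ℕ => (n : ℝ))).comp hup))
    (RunState.measurable_mk (measurable_transcript_snoc htr (hQ.prodMk measurable_const)) hcu hup)
    (Measurable.ite (measurableSet_le (hy.sub hev).abs measurable_const)
      (RunState.measurable_mk (measurable_transcript_snoc htr
        (hQ.prodMk (measurable_inl.comp hev))) hcu hup)
      (RunState.measurable_mk (measurable_transcript_snoc htr
        (hQ.prodMk (measurable_inl.comp hy))) hud
        ((measurable_of_countable (fun n : ℕ => n + 1)).comp hup)))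

lemma LinearQuery.measurable_dot {X Z : Type*} [Fintype X] [MeasurableSpace Z]
    {Q : Z → LinearQuery X} {v : Z → X → ℝ} (hQ : Measurable Q) (hv : Measurable v) :
    Measurable fun z => (Q z).dot (v z) :=
  Finset.measurable_fun_sum _ fun x _ =>
    (measurable_subtype_coe.comp ((measurable_pi_apply x).comp hQ)).mul
      ((measurable_pi_apply x).comp hv)

lemma LinearQuery.measurable_onDatabase {X : Type*} [Fintype X] (D : Database X) :
    Measurable fun Q : LinearQuery X => Q.onDatabase D :=
  LinearQuery.measurable_dot measurable_id measurable_const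

lemma measurable_mechanismRound {X R : Type*} [Fintype X] [MeasurableSpace R]
    {U : UpdateRule X R} (hU : U.IsMeasurable) (B T : ℝ) (D : Database X) (t : ℕ) :
    Measurable fun p : RunState X R t × LinearQuery X × ℝ =>
      mechanismRound U B T D p.1 p.2.1 p.2.2 := by
  simp only [mechanismRound_eq]
  have h1 := (LinearQuery.measurable_onDatabase D).comp
    (f := fun p : RunState X R t × LinearQuery X × ℝ => p.2.1) (by fun_prop)
  have h2 : Measurable fun p : RunState X R t × LinearQuery X × ℝ => p.2.2 := by fun_prop
  exact (measurable_noisyRound hU B T t).comp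
    (measurable_fst.prodMk ((measurable_fst.comp measurable_snd).prodMk (h1.add h2)))

lemma measurable_finInit {t : ℕ} :
    Measurable fun z : Fin (t + 1) → ℝ => (Fin.init z : Fin t → ℝ) :=
  measurable_pi_iff.2 fun i => measurable_pi_apply i.castSucc

/-! ### Privacy -/

lemma runMechanism_snoc {X R Ω : Type*} [Fintype X] [MeasurableSpace Ω] (U : UpdateRule X R)
    (B T : ℝ) (A : Adversary X Ω) (D : Database X) (ω : Ω) (t : ℕ)
    (z : Fin t → ℝ) (y : ℝ) :
    runMechanism U B T A D ω (t + 1) (Fin.snoc z y) =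
      mechanismRound U B T D (runMechanism U B T A D ω t z)
        (A.query t (ω, (runMechanism U B T A D ω t z).transcript)) y := by
  simp [runMechanism, Fin.init_snoc, Fin.snoc_last]

/-- The bound is `B + 1` because `B` is real: the last update may start from any count below `B`. -/
lemma runMechanism_updates_le {X R Ω : Type*} [Fintype X] [MeasurableSpace Ω]
    (U : UpdateRule X R) {B : ℝ} (hB : 0 ≤ B) (T : ℝ) (A : Adversary X Ω) (D : Database X)
    (ω : Ω) (t : ℕ) (z : Fin t → ℝ) :
    ((runMechanism U B T A D ω t z).updates : ℝ) ≤ B + 1 := by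
  induction t with
  | zero => simp [runMechanism]; linarith
  | succ t ih =>
    simp only [runMechanism, mechanismRound]
    split_ifs with h1 h2
    · exact ih _
    · exact ih _
    · push_cast
      linarith [not_le.1 h1]

lemma abs_onDatabase_sub_le {X : Type*} [Fintype X] {D D' : Database X} (h : D.Adjacent D') (Q : LinearQuery X) :
    |Q.onDatabase D - Q.onDatabase D'| ≤ 1 := by
  have h1 : ((∑ x, |(D x : ℤ) - (D' x : ℤ)| : ℤ) : ℝ) ≤ 1 := by
    have h0 : ∑ x, |(D x : ℤ) - (D' x : ℤ)| ≤ 1 := h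
    exact Int.cast_le.2 h0 |>.trans_eq Int.cast_one
  push_cast at h1
  unfold LinearQuery.onDatabase LinearQuery.dot
  rw [← Finset.sum_sub_distrib]
  refine (Finset.abs_sum_le_sum_abs _ _).trans (le_trans (Finset.sum_le_sum fun x _ => ?_) h1)
  rw [← mul_sub, abs_mul, abs_of_nonneg (Q x).2.1]
  exact mul_le_of_le_one_left (abs_nonneg _) (Q x).2.2

/-- The factor `e^{-θ n}`. -/
noncomputable def discount (θ : ℝ) (n : ℕ) : ENNReal := ENNReal.ofReal (Real.exp (-θ * n))

lemma discount_succ (θ : ℝ) (n : ℕ) :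
    discount θ (n + 1) = discount θ n * ENNReal.ofReal (Real.exp (-θ)) := by
  rw [discount, discount, ← ENNReal.ofReal_mul (Real.exp_pos _).le, ← Real.exp_add]
  congr 2
  push_cast
  ring

/-- In terms of the noisy answer the round is the same map for both databases; only the centre of
the Laplace law moves, by at most one. The new state is constant where no update occurs, and
everywhere after termination, so `lintegral_discounted_le` applies with `U` the update event. -/
lemma lintegral_round_le {X R : Type*} [Fintype X] [MeasurableSpace R] {U : UpdateRule X R}
    (hU : U.IsMeasurable) (B T : ℝ) {D D' : Database X}
    (hD : D.Adjacent D') {σ a p θ : ℝ} (hσ : 0 < σ) (hpa : p.HolderConjugate a)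
    (has : a * (Real.exp (1 / σ) - 1) ≤ 1 / 4)
    (hθ : a * θ = 8 * (a * (Real.exp (1 / σ) - 1)) ^ 2) {t : ℕ}
    {h : RunState X R (t + 1) → ENNReal} (hh : Measurable h) (s : RunState X R t)
    (Q : LinearQuery X) :
    ∫⁻ z, h (mechanismRound U B T D s Q z) *
        discount θ (mechanismRound U B T D s Q z).updates ∂laplace σ ≤
      (∫⁻ z, h (mechanismRound U B T D' s Q z) ^ p ∂laplace σ) ^ (1 / p) *
        discount θ s.updates := by
  have hm : Measurable fun y => noisyRound U B T s Q y :=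
    (measurable_noisyRound hU B T t).comp
      (measurable_const.prodMk (measurable_const.prodMk measurable_id))
  have hdisc : Measurable fun s : RunState X R (t + 1) => discount θ s.updates :=
    (measurable_of_countable (discount θ)).comp RunState.measurable_updates
  have hp := hpa.pos
  simp only [mechanismRound_eq]
  rw [lintegral_laplace_add σ _ (F := fun y => h (noisyRound U B T s Q y) *
      discount θ (noisyRound U B T s Q y).updates) ((hh.comp hm).mul (hdisc.comp hm)),
    lintegral_laplace_add σ _ (F := fun y => h (noisyRound U B T s Q y) ^ p)
      ((hh.comp hm).pow_const p)]
  set q := Q.onDatabase D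
  set q' := Q.onDatabase D'
  have hqq : |q - q'| ≤ 1 := abs_onDatabase_sub_le hD Q
  have := isProbabilityMeasure_laplaceAt hσ q
  have := isProbabilityMeasure_laplaceAt hσ q'
  by_cases hB : B ≤ (s.updates : ℝ)
  · have h1 : ∀ y, noisyRound U B T s Q y =
        ⟨Fin.snoc s.transcript (Q, Sum.inr ()), s.current, s.updates⟩ := fun y => by
      simp [noisyRound, hB]
    simp only [h1, lintegral_const, measure_univ, mul_one]
    rw [← ENNReal.rpow_mul, mul_one_div_cancel hp.ne', ENNReal.rpow_one]
  · set W : Set ℝ := {y | ¬ |y - U.eval Q s.current| ≤ T} with hW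
    have hWm : MeasurableSet W :=
      (measurableSet_le (f := fun y : ℝ => |y - U.eval Q s.current|) (by fun_prop)
        measurable_const).compl
    classical
    have h1 : ∀ y, discount θ (noisyRound U B T s Q y).updates =
        discount θ s.updates * (if y ∈ W then ENNReal.ofReal (Real.exp (-θ)) else 1) := by
      intro y
      by_cases hy : |y - U.eval Q s.current| ≤ T
      · simp [noisyRound, hB, hy, hW]
      · simp [noisyRound, hB, hy, hW, discount_succ]
    have hr := measurable_laplaceRatio σ q q'
    have hr1 : ∫ y, laplaceRatio σ q q' y ∂laplaceAt σ q' = 1 := by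
      rw [integral_eq_lintegral_of_nonneg_ae (f := laplaceRatio σ q q')
        (ae_of_all _ fun y => (Real.exp_pos _).le)
        hr.aestronglyMeasurable]
      have := lintegral_laplaceAt_eq σ q q' hσ (F := fun _ => 1) measurable_const
      simp only [one_mul] at this
      rw [← this]
      simp
    have key := lintegral_discounted_le hr (by positivity : 0 ≤ 1 / σ)
      (le_laplaceRatio hσ hqq) (laplaceRatio_le hσ hqq) hr1 hWm hpa has hθ
      (G := fun y => h (noisyRound U B T s Q y)) (hh.comp hm)
      (g := h ⟨Fin.snoc s.transcript (Q, Sum.inl (U.eval Q s.current)), s.current, s.updates⟩)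
      (fun y hy => by
        have hy' : |y - U.eval Q s.current| ≤ T := not_not.1 hy
        simp [noisyRound, hB, hy'])
    rw [lintegral_laplaceAt_eq σ q q' hσ (F := fun y => h (noisyRound U B T s Q y) *
      discount θ (noisyRound U B T s Q y).updates) ((hh.comp hm).mul (hdisc.comp hm)), mul_comm _
      (discount θ s.updates)]
    refine le_trans (le_of_eq ?_) (mul_le_mul_right key (discount θ s.updates))
    rw [← lintegral_const_mul']
    · refine lintegral_congr fun y => ?_
      simp only [h1]
      split_ifs <;> ring
    · exact ENNReal.ofReal_ne_top

section Run

variable {X : Type u} {R : Type w} {Ω : Type v} [Fintype X] [MeasurableSpace R]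
  [MeasurableSpace Ω] {U : UpdateRule X R}

lemma measurable_runMechanism (hU : U.IsMeasurable) (B T : ℝ)
    (A : Adversary X Ω) (D : Database X) (t : ℕ) :
    Measurable fun c : Ω × (Fin t → ℝ) => runMechanism U B T A D c.1 t c.2 := by
  induction t with
  | zero =>
    simp only [runMechanism]
    exact measurable_const
  | succ t ih =>
    have h1 : Measurable fun c : Ω × (Fin (t + 1) → ℝ) =>
        runMechanism U B T A D c.1 t (Fin.init c.2) :=
      ih.comp (measurable_fst.prodMk (measurable_finInit.comp measurable_snd))
    have h2 := (A.measurable_query t).comp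
      (measurable_fst.prodMk (RunState.measurable_transcript.comp h1))
    exact (measurable_mechanismRound hU B T D t).comp
      (h1.prodMk (h2.prodMk ((measurable_pi_apply (Fin.last t)).comp measurable_snd)))

lemma lintegral_pi_snoc {μ : Measure ℝ} [SigmaFinite μ] {t : ℕ} {F : (Fin (t + 1) → ℝ) → ENNReal}
    (hF : Measurable F) :
    ∫⁻ z, F z ∂(Measure.pi fun _ : Fin (t + 1) => μ) =
      ∫⁻ z, ∫⁻ y, F (Fin.snoc z y) ∂μ ∂(Measure.pi fun _ : Fin t => μ) := by
  have h := (measurePreserving_piFinSuccAbove (fun _ : Fin (t + 1) => μ) (Fin.last t)).symm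
  rw [← h.lintegral_comp hF, lintegral_prod_symm]
  · simp [MeasurableEquiv.piFinSuccAbove, Fin.insertNthEquiv, Fin.insertNth_last']
  · exact (hF.comp h.measurable).aemeasurable

/-- Rényi-type comparison of the runs on adjacent databases, discounted by the updates. -/
lemma lintegral_runMechanism_le (hU : U.IsMeasurable) (B T : ℝ) {D D' : Database X}
    (hD : D.Adjacent D') {σ a p θ : ℝ} (hσ : 0 < σ) (hpa : p.HolderConjugate a)
    (has : a * (Real.exp (1 / σ) - 1) ≤ 1 / 4)
    (hθ : a * θ = 8 * (a * (Real.exp (1 / σ) - 1)) ^ 2)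
    (A : Adversary X Ω) (ω : Ω) (t : ℕ) {h : RunState X R t → ENNReal} (hh : Measurable h) :
    ∫⁻ z, h (runMechanism U B T A D ω t z) *
        discount θ (runMechanism U B T A D ω t z).updates
          ∂(Measure.pi fun _ : Fin t => laplace σ) ≤
      (∫⁻ z, h (runMechanism U B T A D' ω t z) ^ p
        ∂(Measure.pi fun _ : Fin t => laplace σ)) ^ (1 / p) := by
  have := isProbabilityMeasure_laplace hσ
  have hp := hpa.pos
  have hrun : ∀ (D : Database X) (t : ℕ), Measurable fun z => runMechanism U B T A D ω t z :=
    fun D t => (measurable_runMechanism hU B T A D t).comp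
      (measurable_const.prodMk measurable_id)
  induction t with
  | zero =>
    simp only [runMechanism, lintegral_const, measure_univ, mul_one]
    rw [← ENNReal.rpow_mul, mul_one_div_cancel hp.ne', ENNReal.rpow_one]
    simp [discount]
  | succ t ih =>
    have hdisc : Measurable fun s : RunState X R (t + 1) => discount θ s.updates :=
      (measurable_of_countable (discount θ)).comp RunState.measurable_updates
    rw [lintegral_pi_snoc (F := fun z => h (runMechanism U B T A D ω (t + 1) z) *
        discount θ (runMechanism U B T A D ω (t + 1) z).updates)
        ((hh.mul hdisc).comp (hrun D _)),
      lintegral_pi_snoc (F := fun z => h (runMechanism U B T A D' ω (t + 1) z) ^ p)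
        ((hh.pow_const p).comp (hrun D' _))]
    simp only [runMechanism_snoc]
    -- The last round is moved to `D'` first. Its conditional `L^p` norm is the test function for
    -- the earlier rounds, and raising it to the power `p` restores the full integral.
    set h' : RunState X R t → ENNReal := fun s =>
      (∫⁻ y, h (mechanismRound U B T D' s (A.query t (ω, s.transcript)) y) ^ p
        ∂laplace σ) ^ (1 / p) with hh'
    have hm : Measurable h' := by
      have h1 : Measurable fun c : RunState X R t × ℝ =>
          h (mechanismRound U B T D' c.1 (A.query t (ω, c.1.transcript)) c.2) ^ p := by
        have h3 : Measurable fun c : RunState X R t × ℝ => (ω, c.1.transcript) :=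
          measurable_const.prodMk (RunState.measurable_transcript.comp measurable_fst)
        have h2 := (A.measurable_query t).comp h3
        exact ((hh.comp (measurable_mechanismRound hU B T D' t)).comp
          (measurable_fst.prodMk (h2.prodMk measurable_snd))).pow_const p
      exact h1.lintegral_prod_right'.pow_const _
    have h2 := ih hm
    refine le_trans (lintegral_mono fun z => ?_) (h2.trans (le_of_eq ?_))
    · exact lintegral_round_le hU B T hD hσ hpa has hθ hh _ _
    · congr 1
      refine lintegral_congr fun z => ?_
      rw [hh', ← ENNReal.rpow_mul, one_div_mul_cancel hp.ne', ENNReal.rpow_one]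

end Run

/-- From a Rényi-type bound on probabilities to an approximate one. -/
lemma le_exp_mul_add_of_le_rpow {x y a c ε δ : ℝ} (hy : 0 ≤ y) (ha : 1 < a)
    (hδ : 0 < δ) (hca : c * a ≤ 1) (hae : ε * (a - 1) = Real.log (4 / δ))
    (hx : x ≤ Real.exp c * y ^ (1 - 1 / a)) : x ≤ Real.exp ε * y + δ := by
  have ha0 : 0 < a := by linarith
  have h1a : 0 < 1 - 1 / a := by
    rw [sub_pos, div_lt_one ha0]; exact ha
  rcases hy.eq_or_lt with h0 | h0
  · rw [← h0, Real.zero_rpow h1a.ne'] at hx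
    rw [← h0]
    linarith
  -- If `y` is large, the missing factor `y^{1/a}` pays for `e^{c-ε}`. If `y` is small, the whole
  -- bound is at most `e^{ca - ε(a-1)} ≤ eδ/4`.
  by_cases h : Real.exp (c - ε) ≤ y ^ (1 / a)
  · have h1 : y = y ^ (1 - 1 / a) * y ^ (1 / a) := by
      rw [← Real.rpow_add h0]; simp
    have h2 : Real.exp c * y ^ (1 - 1 / a) ≤ Real.exp ε * y := by
      calc Real.exp c * y ^ (1 - 1 / a) =
          Real.exp ε * (y ^ (1 - 1 / a) * Real.exp (c - ε)) := by
            rw [Real.exp_sub]; field_simp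
        _ ≤ Real.exp ε * (y ^ (1 - 1 / a) * y ^ (1 / a)) := by gcongr
        _ = _ := by rw [← h1]
    linarith
  · have h1 : y ≤ Real.exp ((c - ε) * a) := by
      have h2 := Real.rpow_le_rpow (by positivity) (not_le.1 h).le ha0.le
      rw [← Real.rpow_mul hy, one_div_mul_cancel ha0.ne', Real.rpow_one, ← Real.exp_mul] at h2
      exact h2
    have h2 : y ^ (1 - 1 / a) ≤ Real.exp ((c - ε) * (a - 1)) := by
      have h3 := Real.rpow_le_rpow hy h1 h1a.le
      rw [← Real.exp_mul] at h3
      convert h3 using 2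
      field_simp
    have h3 : Real.exp c * y ^ (1 - 1 / a) ≤ Real.exp (1 - Real.log (4 / δ)) := by
      refine (mul_le_mul_of_nonneg_left h2 (Real.exp_pos c).le).trans ?_
      rw [← Real.exp_add]
      refine Real.exp_le_exp.2 ?_
      rw [← hae]
      linarith
    rw [Real.exp_sub, Real.exp_log (by positivity)] at h3
    have h4 : Real.exp 1 / (4 / δ) ≤ δ := by
      rw [div_div_eq_mul_div, div_le_iff₀ (by norm_num)]
      nlinarith [Real.exp_one_lt_d9]
    have := mul_nonneg (Real.exp_pos ε).le hy
    linarith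

lemma one_lt_log_four_div {δ : ℝ} (hδ : 0 < δ) (hδ1 : δ ≤ 1) : 1 < Real.log (4 / δ) := by
  rw [Real.lt_log_iff_exp_lt (by positivity), lt_div_iff₀ hδ]
  nlinarith [Real.exp_one_lt_d9, Real.exp_pos 1]

lemma noiseScale_pos {B ε δ : ℝ} (hB : 0 < B) (hε : 0 < ε) (hδ : 0 < δ) (hδ1 : δ ≤ 1) :
    0 < noiseScale B ε δ := by
  have := one_lt_log_four_div hδ hδ1
  have := Real.sqrt_pos.2 hB
  unfold noiseScale
  positivity

lemma releaseIsPrivate {X : Type u} {R : Type w} [Fintype X] [MeasurableSpace R]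
    {U : UpdateRule X R} (hU : U.IsMeasurable) {B ε δ : ℝ} (hB : 1 ≤ B) (hε : 0 < ε) (hε1 : ε ≤ 1)
    (hδ : 0 < δ) (hδ1 : δ ≤ 1) (β : ℝ) (k : ℕ) : ReleaseIsPrivate.{v} U B ε δ β k := by
  intro Ω _ ν _ A D D' hD S hS
  set T := updateThreshold B ε δ β k
  set σ := noiseScale B ε δ with hσdef
  have hσ : 0 < σ := noiseScale_pos (by linarith) hε hδ hδ1
  have := isProbabilityMeasure_laplace hσ
  set L := Real.log (4 / δ) with hL
  have hL1 : 1 < L := one_lt_log_four_div hδ hδ1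
  -- The order for which `ε(a - 1) = log(4/δ)`. As `a ≤ 2L/ε`, the noise scale gives `a/σ ≤
  -- 1/(500√B)`.
  set a := 1 + L / ε with ha
  have ha1 : 1 < a := by have : 0 < L / ε := by positivity
                         linarith
  have ha0 : 0 < a := by linarith
  have hsq : 1 ≤ √B := Real.one_le_sqrt.2 hB
  have hB0 : 0 ≤ B := by linarith
  have haσ : a * (1 / σ) ≤ 1 / (500 * √B) := by
    have h1 : a ≤ 2 * L / ε := by
      rw [ha, le_div_iff₀ hε, add_mul, div_mul_cancel₀ _ hε.ne']
      linarith
    have h2 : 1 / σ = ε / (1000 * √B * L) := by rw [hσdef, noiseScale, one_div_div]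
    rw [h2]
    calc a * (ε / (1000 * √B * L)) ≤ 2 * L / ε * (ε / (1000 * √B * L)) := by gcongr
      _ = _ := by field_simp; norm_num
  have hs1 : 1 / σ ≤ 1 := by
    have h1 : 1 / (500 * √B) ≤ 1 := by rw [div_le_one (by positivity)]; linarith
    have h2 : 1 / σ ≤ a * (1 / σ) := le_mul_of_one_le_left (by positivity) ha1.le
    linarith
  have he : Real.exp (1 / σ) - 1 ≤ 2 * (1 / σ) := by
    have h0 : 0 ≤ 1 / σ := by positivity
    have := exp_le_one_add_add_sq (x := 1 / σ) (by rwa [abs_of_nonneg h0])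
    nlinarith
  have he0 : 0 ≤ Real.exp (1 / σ) - 1 := by
    have h0 : 0 ≤ 1 / σ := by positivity
    linarith [Real.add_one_le_exp (1 / σ)]
  have hae : a * (Real.exp (1 / σ) - 1) ≤ 1 / (250 * √B) := by
    calc _ ≤ a * (2 * (1 / σ)) := by gcongr
      _ = 2 * (a * (1 / σ)) := by ring
      _ ≤ 2 * (1 / (500 * √B)) := by gcongr
      _ = _ := by field_simp; norm_num
  have has : a * (Real.exp (1 / σ) - 1) ≤ 1 / 4 := by
    refine hae.trans ?_
    rw [div_le_div_iff₀ (by positivity) (by norm_num)]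
    linarith
  set κ := (a * (Real.exp (1 / σ) - 1)) ^ 2 with hκ
  have hκB : κ * B ≤ 1 / 62500 := by
    have h1 : κ ≤ (1 / (250 * √B)) ^ 2 := pow_le_pow_left₀ (by positivity) hae 2
    rw [div_pow, mul_pow, Real.sq_sqrt hB0] at h1
    calc κ * B ≤ 1 ^ 2 / (250 ^ 2 * B) * B := by gcongr
      _ = _ := by field_simp; norm_num
  have hκ0 : 0 ≤ κ := sq_nonneg _
  set θ := 8 * κ / a with hθdef
  have hθ : a * θ = 8 * κ := by rw [hθdef]; field_simp
  have hθ0 : 0 ≤ θ := by positivity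
  have hpa : (a.conjExponent).HolderConjugate a := (Real.HolderConjugate.conjExponent ha1).symm
  set p := a.conjExponent with hp
  have hp0 := hpa.pos
  have h1p : 1 / p = 1 - 1 / a := by
    have := hpa.inv_add_inv_eq_one
    rw [one_div, one_div]; linarith
  have hview : ∀ D : Database X, Measurable (view U B T k A D) := fun D =>
    measurable_fst.prodMk (RunState.measurable_transcript.comp
      (measurable_runMechanism hU B T A D k))
  -- The adversary's coins have the same law for both databases, so they can be fixed and integrated
  -- out at the end.
  have hpt : ∀ ω : Ω, (Measure.pi fun _ : Fin k => laplace σ)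
        (Prod.mk ω ⁻¹' (view U B T k A D ⁻¹' S)) ≤
      ENNReal.ofReal (Real.exp ε) * (Measure.pi fun _ : Fin k => laplace σ)
        (Prod.mk ω ⁻¹' (view U B T k A D' ⁻¹' S)) + ENNReal.ofReal δ := by
    intro ω
    set π := Measure.pi fun _ : Fin k => laplace σ with hπ
    set V : Set (RunState X R k) := {s | (ω, s.transcript) ∈ S} with hV
    have hVm : MeasurableSet V :=
      (measurable_const.prodMk RunState.measurable_transcript : Measurable
        fun s : RunState X R k => (ω, s.transcript)) hS
    have hrun : ∀ D : Database X, Measurable fun z => runMechanism U B T A D ω k z :=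
      fun D => (measurable_runMechanism hU B T A D k).comp
        (measurable_const.prodMk measurable_id)
    have key := lintegral_runMechanism_le hU B T hD hσ hpa has hθ A ω k
      (h := V.indicator 1) (measurable_one.indicator hVm)
    set c := θ * (B + 1) with hc
    have hind : ∀ D : Database X, ∫⁻ z, V.indicator 1 (runMechanism U B T A D ω k z) ∂π =
        π (Prod.mk ω ⁻¹' (view U B T k A D ⁻¹' S)) := by
      intro D
      exact lintegral_indicator_one ((hrun D) hVm)
    have hlow : π (Prod.mk ω ⁻¹' (view U B T k A D ⁻¹' S)) * ENNReal.ofReal (Real.exp (-c)) ≤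
        ∫⁻ z, V.indicator 1 (runMechanism U B T A D ω k z) *
          discount θ (runMechanism U B T A D ω k z).updates ∂π := by
      rw [← hind D, ← lintegral_mul_const' _ _ ENNReal.ofReal_ne_top]
      refine lintegral_mono fun z => mul_le_mul_right ?_ _
      refine ENNReal.ofReal_le_ofReal (Real.exp_le_exp.2 ?_)
      have := runMechanism_updates_le U hB0 T A D ω k z
      have := mul_le_mul_of_nonneg_left this hθ0
      rw [hc]
      linarith
    have hpow : ∀ s, (V.indicator 1 s : ENNReal) ^ p = V.indicator 1 s := by
      intro s
      by_cases hs : s ∈ V <;> simp [hs, hp0]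
    simp only [hpow] at key
    rw [hind D'] at key
    have key2 := hlow.trans key
    set x := π (Prod.mk ω ⁻¹' (view U B T k A D ⁻¹' S)) with hx
    set y := π (Prod.mk ω ⁻¹' (view U B T k A D' ⁻¹' S)) with hy
    have hxt : x ≠ ⊤ := measure_ne_top _ _
    have hyt : y ≠ ⊤ := measure_ne_top _ _
    have key3 := ENNReal.toReal_mono (ENNReal.rpow_ne_top_of_nonneg (by positivity) hyt) key2
    rw [ENNReal.toReal_mul, ← ENNReal.toReal_rpow, ENNReal.toReal_ofReal (Real.exp_pos _).le,
      h1p] at key3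
    have key4 : x.toReal ≤ Real.exp c * y.toReal ^ (1 - 1 / a) := by
      rw [Real.exp_neg, ← div_eq_mul_inv, div_le_iff₀ (Real.exp_pos c)] at key3
      linarith
    -- `B + 1 ≤ 2B` because `B ≥ 1`, and `16κB` is far below one.
    have hca : c * a ≤ 1 := by
      have : c * a = 8 * κ * (B + 1) := by rw [hc, ← hθ]; ring
      rw [this]
      nlinarith
    have key5 := le_exp_mul_add_of_le_rpow (ε := ε) ENNReal.toReal_nonneg ha1 hδ hca
      (by rw [ha, ← hL]; field_simp; ring) key4
    rw [← ENNReal.ofReal_toReal hxt, ← ENNReal.ofReal_toReal hyt,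
      ← ENNReal.ofReal_mul (Real.exp_pos _).le, ← ENNReal.ofReal_add (by positivity) hδ.le]
    exact ENNReal.ofReal_le_ofReal key5
  unfold coinLaw
  rw [Measure.prod_apply (hview D hS), Measure.prod_apply (hview D' hS)]
  refine (lintegral_mono hpt).trans ?_
  rw [lintegral_add_right _ measurable_const,
    lintegral_const_mul _ (measurable_measure_prodMk_left (hview D' hS))]
  simp

/-! ### Accuracy -/

/-- `Inv S c` is an invariant of the data structure `S` and the number `c` of updates, for runs of
the mechanism on `D` with queries in `𝒬` and noise at most `T / 4`, that guarantees error at most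
`a` and fewer than `B` updates. -/
structure AccuracyInvariant {X R : Type*} [Fintype X] (U : UpdateRule X R) (B T : ℝ)
    (D : Database X) (𝒬 : Set (LinearQuery X)) (a : ℝ) (Inv : R → ℕ → Prop) : Prop where
  init : Inv U.init 0
  lt_budget : ∀ S c, Inv S c → (c : ℝ) < B
  update : ∀ S c, Inv S c → ∀ Q ∈ 𝒬, ∀ noisy, T < |noisy - U.eval Q S| →
    |noisy - Q.onDatabase D| ≤ T / 4 → Inv (U.update S Q noisy) (c + 1) ∧ T / 4 ≤ a
  guess : ∀ S c, Inv S c → ∀ Q ∈ 𝒬, |Q.onDatabase D - U.eval Q S| ≤ 5 * T / 4 →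
    |Q.onDatabase D - U.eval Q S| ≤ a

/-- With the noise bounded, the statement is deterministic. The set `𝒬` constrains only the queries
that actually occur, so it may be chosen from the finished run. -/
lemma runMechanism_accurate {X R Ω : Type*} [Fintype X] [MeasurableSpace Ω] {U : UpdateRule X R}
    {B T a : ℝ} {D : Database X} {𝒬 : Set (LinearQuery X)} {Inv : R → ℕ → Prop}
    (hI : AccuracyInvariant U B T D 𝒬 a Inv) (A : Adversary X Ω) (ω : Ω) (t : ℕ)
    (z : Fin t → ℝ) (hz : ∀ i, |z i| ≤ T / 4)
    (hQ : ∀ i, ((runMechanism U B T A D ω t z).transcript i).1 ∈ 𝒬) :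
    Inv (runMechanism U B T A D ω t z).current (runMechanism U B T A D ω t z).updates ∧
      (runMechanism U B T A D ω t z).transcript.AccurateFor D a := by
  induction t with
  | zero => exact ⟨hI.init, fun i => i.elim0⟩
  | succ t ih =>
    obtain ⟨z, y, rfl⟩ : ∃ z' y, z = Fin.snoc z' y := ⟨Fin.init z, z (Fin.last t), by simp⟩
    have hz' : ∀ i, |z i| ≤ T / 4 := fun i => by simpa using hz i.castSucc
    have hy : |y| ≤ T / 4 := by simpa using hz (Fin.last t)
    rw [runMechanism_snoc] at hQ ⊢
    set s := runMechanism U B T A D ω t z with hs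
    set Q := A.query t (ω, s.transcript)
    have hfst : ∀ i, ((mechanismRound U B T D s Q y).transcript i).1 =
        (Fin.snoc (fun i => (s.transcript i).1) Q : Fin (t + 1) → LinearQuery X) i := by
      intro i
      have hcases : ∃ b, (mechanismRound U B T D s Q y).transcript =
          Fin.snoc s.transcript (Q, b) := by
        unfold mechanismRound
        dsimp only
        split_ifs <;> exact ⟨_, rfl⟩
      obtain ⟨b, hb⟩ := hcases
      rw [hb]
      induction i using Fin.lastCases <;> simp
    have hQ1 : Q ∈ 𝒬 := by
      have := hQ (Fin.last t)
      rw [hfst] at this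
      simpa using this
    have hQ2 : ∀ i, (s.transcript i).1 ∈ 𝒬 := fun i => by
      have := hQ i.castSucc
      rw [hfst] at this
      simpa using this
    obtain ⟨ih1, ih2⟩ := ih z hz' hQ2
    have hlt := hI.lt_budget _ _ ih1
    unfold mechanismRound
    rw [if_neg (not_le.2 hlt)]
    have hnoisy : |Q.onDatabase D + y - Q.onDatabase D| ≤ T / 4 := by simpa using hy
    split_ifs with h
    · refine ⟨ih1, fun i => ?_⟩
      induction i using Fin.lastCases with
      | last =>
        refine ⟨U.eval Q s.current, by simp, ?_⟩
        simp only [Fin.snoc_last]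
        refine hI.guess _ _ ih1 Q hQ1 ?_
        have h1 := abs_add_le (Q.onDatabase D + y - U.eval Q s.current) (-y)
        rw [abs_neg, show Q.onDatabase D + y - U.eval Q s.current + -y =
          Q.onDatabase D - U.eval Q s.current by ring] at h1
        linarith
      | cast i => simpa using ih2 i
    · obtain ⟨h1, h2⟩ := hI.update _ _ ih1 Q hQ1 _ (not_le.1 h) hnoisy
      refine ⟨h1, fun i => ?_⟩
      induction i using Fin.lastCases with
      | last =>
        refine ⟨Q.onDatabase D + y, by simp, ?_⟩
        simp only [Fin.snoc_last]
        rw [abs_sub_comm]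
        exact hnoisy.trans h2
      | cast i => simpa using ih2 i

lemma laplace_abs_le {σ t : ℝ} (hσ : 0 < σ) (ht : 0 ≤ t) :
    laplace σ {x | |x| ≤ t} = ENNReal.ofReal (1 - Real.exp (-t / σ)) := by
  have := isProbabilityMeasure_laplace hσ
  have hm : MeasurableSet {x : ℝ | t < |x|} := measurableSet_lt measurable_const (by fun_prop)
  have h : {x : ℝ | |x| ≤ t} = {x | t < |x|}ᶜ := by ext; simp
  rw [h, prob_compl_eq_one_sub hm, laplace_lt_abs hσ ht,
    ENNReal.ofReal_sub _ (Real.exp_pos _).le, ENNReal.ofReal_one]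

lemma releaseIsAccurate {X : Type u} {R : Type w} [Fintype X] {U : UpdateRule X R}
    {B ε δ β a : ℝ} {k n : ℕ} (hB : 0 < B) (hε : 0 < ε) (hδ : 0 < δ) (hδ1 : δ ≤ 1)
    (hβ : 0 < β) (hβ1 : β ≤ 1) (hk : 1 ≤ k)
    (h : ∀ D : Database X, D.size = n → ∀ Qs : Fin k → LinearQuery X, ∃ Inv : R → ℕ → Prop,
      AccuracyInvariant U B (updateThreshold B ε δ β k) D (Set.range Qs) a Inv) :
    ReleaseIsAccurate.{v} U B ε δ β k n a := by
  intro Ω _ ν _ A D hD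
  set σ := noiseScale B ε δ with hσdef
  have hσ : 0 < σ := noiseScale_pos hB hε hδ hδ1
  have := isProbabilityMeasure_laplace hσ
  have hk0 : (1 : ℝ) ≤ k := by exact_mod_cast hk
  have hkβ : 1 ≤ 2 * k / β := by rw [le_div_iff₀ hβ]; linarith
  set T := updateThreshold B ε δ β k with hT
  have hT4 : T / 4 = σ * Real.log (2 * k / β) := by rw [hT, updateThreshold]; ring
  have hT0 : 0 ≤ T / 4 := by
    rw [hT4]
    exact mul_nonneg hσ.le (Real.log_nonneg hkβ)
  set G : Set (Ω × (Fin k → ℝ)) := Set.univ ×ˢ (Set.univ.pi fun _ => {x : ℝ | |x| ≤ T / 4}) with hG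
  have hsub : G ⊆ {c | (view U B T k A D c).2.AccurateFor D a} := by
    rintro ⟨ω, z⟩ hz
    -- The invariant is chosen in hindsight from the queries asked. Adaptivity costs nothing, since
    -- the event `G` concerns the noise alone.
    obtain ⟨Inv, hI⟩ := h D hD fun i => ((runMechanism U B T A D ω k z).transcript i).1
    refine (runMechanism_accurate hI A ω k z (fun i => ?_) fun i => ⟨i, rfl⟩).2
    simpa [hG] using hz.2 i
  refine le_trans ?_ (measure_mono hsub)
  have hexp : Real.exp (-(T / 4) / σ) = β / (2 * k) := by
    rw [hT4, neg_div, mul_div_cancel_left₀ _ hσ.ne', Real.exp_neg, Real.exp_log (by linarith),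
      inv_div]
  have hb1 : β / (2 * k) ≤ 1 := by rw [div_le_one (by positivity)]; linarith
  rw [coinLaw, hG, Measure.prod_prod, Measure.pi_pi, measure_univ, one_mul, Finset.prod_const,
    Finset.card_univ, Fintype.card_fin, laplace_abs_le hσ hT0, hexp,
    ← ENNReal.ofReal_pow (by linarith)]
  refine ENNReal.ofReal_le_ofReal ?_
  -- Each noise exceeds `T/4` with probability `β/(2k)`; Bernoulli's inequality leaves failure
  -- probability at most `β/2`.
  have hbern := one_add_mul_le_pow (a := -(β / (2 * k))) (by linarith) k
  have : (k : ℝ) * -(β / (2 * k)) = - (β / 2) := by field_simp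
  rw [this, ← sub_eq_add_neg, ← sub_eq_add_neg] at hbern
  linarith

lemma LinearQuery.dot_const_mul {X : Type*} [Fintype X] (Q : LinearQuery X) (c : ℝ) (v : X → ℝ) :
    Q.dot (fun x => c * v x) = c * Q.dot v := by
  unfold LinearQuery.dot
  rw [Finset.mul_sum]
  exact Finset.sum_congr rfl fun x _ => by ring

lemma LinearQuery.dot_nonneg {X : Type*} [Fintype X] (Q : LinearQuery X) {v : X → ℝ}
    (hv : ∀ x, 0 ≤ v x) : 0 ≤ Q.dot v :=
  Finset.sum_nonneg fun x _ => mul_nonneg (Q x).2.1 (hv x)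

lemma LinearQuery.dot_le {X : Type*} [Fintype X] (Q : LinearQuery X) {v : X → ℝ}
    (hv : ∀ x, 0 ≤ v x) : Q.dot v ≤ ∑ x, v x :=
  Finset.sum_le_sum fun x _ => mul_le_of_le_one_left (hv x) (Q x).2.2

lemma Database.sum_cast {X : Type*} [Fintype X] (D : Database X) :
    ∑ x, (D x : ℝ) = D.size := by
  simp [Database.size]

lemma LinearQuery.onDatabase_mem {X : Type*} [Fintype X] (Q : LinearQuery X) (D : Database X) :
    0 ≤ Q.onDatabase D ∧ Q.onDatabase D ≤ D.size := by
  rw [← D.sum_cast]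
  exact ⟨Q.dot_nonneg fun x => by positivity, Q.dot_le fun x => by positivity⟩

/-- If the initial data structure always answers in `[0, n]` and `n` is below the update threshold
by a margin, then no update occurs. -/
lemma AccuracyInvariant.of_le {X R : Type*} [Fintype X] {U : UpdateRule X R} {B T a : ℝ} {n : ℕ}
    {D : Database X} (hD : D.size = n) (hB : 0 < B) (hn : (n : ℝ) ≤ 3 * T / 4) (ha : n ≤ a)
    (heval : ∀ Q, 0 ≤ U.eval Q U.init ∧ U.eval Q U.init ≤ n) (𝒬 : Set (LinearQuery X)) :
    AccuracyInvariant U B T D 𝒬 a (fun S c => S = U.init ∧ c = 0) where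
  init := ⟨rfl, rfl⟩
  lt_budget := by
    rintro S c ⟨rfl, rfl⟩
    simpa using hB
  update := by
    rintro S c ⟨rfl, rfl⟩ Q _ noisy h1 h2
    exfalso
    have h3 := heval Q
    have h4 := Q.onDatabase_mem D
    rw [hD] at h4
    have h5 := abs_add_le (noisy - Q.onDatabase D) (Q.onDatabase D - U.eval Q U.init)
    rw [sub_add_sub_cancel] at h5
    have h6 : |Q.onDatabase D - U.eval Q U.init| ≤ n := abs_le.2 ⟨by linarith, by linarith⟩
    linarith
  guess := by
    rintro S c ⟨rfl, rfl⟩ Q _ _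
    have h3 := heval Q
    have h4 := Q.onDatabase_mem D
    rw [hD] at h4
    exact abs_le.2 ⟨by linarith, by linarith⟩

/-! ### Multiplicative weights -/

section MultiplicativeWeights

variable {X : Type*} [Fintype X]

/-- The multiplicative weights update of `p` by the penalty `r`, not normalized. -/
noncomputable def mwWeight (η : ℝ) (r p : X → ℝ) (x : X) : ℝ := Real.exp (-η * r x) * p x

lemma sum_mwWeight_pos {η : ℝ} {r p : X → ℝ} (hp : ∀ x, 0 < p x) (hp1 : ∑ x, p x = 1) :
    0 < ∑ x, mwWeight η r p x := by
  have hne : (Finset.univ : Finset X).Nonempty := by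
    by_contra h
    rw [Finset.not_nonempty_iff_eq_empty.1 h] at hp1
    simp at hp1
  exact Finset.sum_pos (fun x _ => mul_pos (Real.exp_pos _) (hp x)) hne

/-- The exponential weights contribute `η⟨q, r⟩` exactly and the normalization contributes `log W ≤
W - 1`, where the quadratic bound for `e^{-t}` gives `W ≤ 1 - η⟨p, r⟩ + η²/2`. -/
lemma mwWeight_potential {η : ℝ} {r p q : X → ℝ} (hη : 0 ≤ η) (hr0 : ∀ x, 0 ≤ r x)
    (hr1 : ∀ x, r x ≤ 1) (hp : ∀ x, 0 < p x) (hp1 : ∑ x, p x = 1)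
    (hq1 : ∑ x, q x = 1) :
    -∑ x, q x * Real.log (mwWeight η r p x / ∑ y, mwWeight η r p y) ≤
      -∑ x, q x * Real.log (p x) + η * (∑ x, q x * r x - ∑ x, p x * r x) + η ^ 2 / 2 := by
  set W := ∑ y, mwWeight η r p y with hW
  have hW0 : 0 < W := sum_mwWeight_pos hp hp1
  have hlog : ∀ x, Real.log (mwWeight η r p x / W) = -η * r x + Real.log (p x) - Real.log W := by
    intro x
    rw [mwWeight, Real.log_div (mul_pos (Real.exp_pos _) (hp x)).ne' hW0.ne',
      Real.log_mul (Real.exp_pos _).ne' (hp x).ne', Real.log_exp]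
  have h1 : -∑ x, q x * Real.log (mwWeight η r p x / W) =
      -∑ x, q x * Real.log (p x) + η * (∑ x, q x * r x) + Real.log W := by
    have : Real.log W = ∑ x, q x * Real.log W := by rw [← Finset.sum_mul, hq1, one_mul]
    rw [this, Finset.mul_sum, ← Finset.sum_neg_distrib, ← Finset.sum_neg_distrib,
      ← Finset.sum_add_distrib, ← Finset.sum_add_distrib]
    refine Finset.sum_congr rfl fun x _ => ?_
    rw [hlog]
    ring
  have h2 : W ≤ 1 - η * (∑ x, p x * r x) + η ^ 2 / 2 := by
    have : (1 : ℝ) - η * (∑ x, p x * r x) + η ^ 2 / 2 =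
        ∑ x, (p x - η * (p x * r x) + p x * (η ^ 2 / 2)) := by
      rw [Finset.sum_add_distrib, Finset.sum_sub_distrib, ← Finset.mul_sum, ← Finset.sum_mul, hp1,
        one_mul]
    rw [this]
    refine Finset.sum_le_sum fun x _ => ?_
    have h3 := exp_neg_le_quadratic (mul_nonneg hη (hr0 x))
    have h4 : (η * r x) ^ 2 ≤ η ^ 2 := by
      rw [mul_pow]
      exact mul_le_of_le_one_right (sq_nonneg η) (pow_le_one₀ (hr0 x) (hr1 x))
    rw [mwWeight, neg_mul]
    calc Real.exp (-(η * r x)) * p x ≤ (1 - η * r x + η ^ 2 / 2) * p x :=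
          mul_le_mul_of_nonneg_right (by linarith) (hp x).le
      _ = _ := by ring
  have h3 := Real.log_le_sub_one_of_pos hW0
  rw [h1]
  linarith

lemma mwRule_update (n : ℕ) (α : ℝ) (p : X → ℝ) (Q : LinearQuery X) (y : ℝ) :
    (mwRule X n α).update p Q y = fun x =>
      mwWeight (α / (2 * n)) (mwPenalty Q y (n * Q.dot p)) p x /
        ∑ y', mwWeight (α / (2 * n)) (mwPenalty Q y (n * Q.dot p)) p y' := rfl

lemma mwRule_isMeasurable (n : ℕ) (α : ℝ) : (mwRule X n α).IsMeasurable where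
  measurable_eval := (LinearQuery.measurable_dot measurable_fst measurable_snd).const_mul _
  measurable_update := by
    have hp : Measurable fun a : (X → ℝ) × LinearQuery X × ℝ => a.1 := measurable_fst
    have hQ : Measurable fun a : (X → ℝ) × LinearQuery X × ℝ => a.2.1 := by fun_prop
    have hy : Measurable fun a : (X → ℝ) × LinearQuery X × ℝ => a.2.2 := by fun_prop
    have hd := (LinearQuery.measurable_dot hQ hp).const_mul (n : ℝ)
    have hw : ∀ x, Measurable fun a : (X → ℝ) × LinearQuery X × ℝ =>
        mwWeight (α / (2 * n)) (mwPenalty a.2.1 a.2.2 (n * a.2.1.dot a.1)) a.1 x := by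
      intro x
      have hQx : Measurable fun a : (X → ℝ) × LinearQuery X × ℝ => ((a.2.1 x : ℝ)) :=
        measurable_subtype_coe.comp ((measurable_pi_apply x).comp hQ)
      have hr : Measurable fun a : (X → ℝ) × LinearQuery X × ℝ =>
          mwPenalty a.2.1 a.2.2 (n * a.2.1.dot a.1) x :=
        Measurable.ite (measurableSet_lt hy hd) hQx (measurable_const.sub hQx)
      exact ((hr.const_mul _).exp).mul ((measurable_pi_apply x).comp hp)
    simp only [mwRule_update]
    exact measurable_pi_iff.2 fun x =>
      (hw x).div (Finset.measurable_fun_sum _ fun x _ => hw x)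

/-- The invariant of multiplicative weights: `p` is a positive probability vector whose cross
entropy relative to `D` decreases with each update. -/
def mwInvariant (n : ℕ) (α : ℝ) (D : Database X) (p : X → ℝ) (c : ℕ) : Prop :=
  (∀ x, 0 < p x) ∧ ∑ x, p x = 1 ∧
    -∑ x, ((D x : ℝ) / n) * Real.log (p x) + c * (3 * α ^ 2 / (8 * (n : ℝ) ^ 2)) ≤
      Real.log (Fintype.card X)

lemma mwInvariant_accuracy {n : ℕ} {α T a : ℝ} {D : Database X} (hD : D.size = n) (hn : 1 ≤ n)
    (hX : 2 ≤ Fintype.card X) (hα : 0 < α) (hαT : α ≤ 3 * T / 4) (hTa : 5 * T / 4 ≤ a)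
    (𝒬 : Set (LinearQuery X)) :
    AccuracyInvariant (mwRule X n α) (mwBudget X n α) T D 𝒬 a (mwInvariant n α D) := by
  have hn0 : (0 : ℝ) < n := by exact_mod_cast hn
  have hX0 : (1 : ℝ) < Fintype.card X := by exact_mod_cast hX
  have hlogX := Real.log_pos hX0
  have hq1 : ∑ x, ((D x : ℝ) / n) = 1 := by
    rw [← Finset.sum_div, D.sum_cast, hD, div_self hn0.ne']
  have hq0 : ∀ x, 0 ≤ (D x : ℝ) / n := fun x => by positivity
  have hDdot : ∀ Q : LinearQuery X, Q.onDatabase D = n * ∑ x, ((D x : ℝ) / n) * Q x := by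
    intro Q
    rw [LinearQuery.onDatabase, LinearQuery.dot, Finset.mul_sum]
    exact Finset.sum_congr rfl fun x _ => by field_simp
  refine ⟨?_, ?_, ?_, ?_⟩
  · refine ⟨fun x => by simp only [mwRule]; positivity, ?_, ?_⟩
    · simp only [mwRule, Finset.sum_const, Finset.card_univ, nsmul_eq_mul]
      field_simp
    · simp only [mwRule, one_div, Real.log_inv, mul_neg, Finset.sum_neg_distrib, neg_neg]
      rw [← Finset.sum_mul, hq1]
      simp
  · rintro p c ⟨hp, hp1, hΦ⟩
    have h1 : 0 ≤ -∑ x, ((D x : ℝ) / n) * Real.log (p x) := by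
      rw [← Finset.sum_neg_distrib]
      refine Finset.sum_nonneg fun x _ => ?_
      have h2 : p x ≤ 1 := by
        rw [← hp1]
        exact Finset.single_le_sum (fun y _ => (hp y).le) (Finset.mem_univ x)
      have := Real.log_nonpos (hp x).le h2
      have := mul_nonneg (hq0 x) (neg_nonneg.2 this)
      linarith
    have h2 : (c : ℝ) * (3 * α ^ 2 / (8 * (n : ℝ) ^ 2)) ≤ Real.log (Fintype.card X) := by linarith
    -- The potential allows `8/3` in place of the budget's factor `4`, so the inequality is strict.
    rw [mwBudget, lt_div_iff₀ (by positivity)]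
    rw [mul_div_assoc', div_le_iff₀ (by positivity)] at h2
    have : 0 < (n : ℝ) ^ 2 * Real.log (Fintype.card X) := by positivity
    linarith
  · rintro p c ⟨hp, hp1, hΦ⟩ Q _ y hT hy
    have hT0 : 0 < T := by linarith
    refine ⟨?_, by linarith⟩
    set r := mwPenalty Q y (n * Q.dot p) with hr
    have heval : (mwRule X n α).eval Q p = n * ∑ x, p x * Q x := by
      simp only [mwRule, LinearQuery.dot, mul_comm]
    have heval' : (mwRule X n α).eval Q p = n * Q.dot p := rfl
    have hr0 : ∀ x, 0 ≤ r x := fun x => by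
      rw [hr, mwPenalty]
      split_ifs
      · exact (Q x).2.1
      · linarith [(Q x).2.2]
    have hr1 : ∀ x, r x ≤ 1 := fun x => by
      rw [hr, mwPenalty]
      split_ifs
      · exact (Q x).2.2
      · linarith [(Q x).2.1]
    -- The noise is too small to hide the sign of the error, so the penalty falls on the side where
    -- `p` is too heavy, by at least `(3T/4)/n ≥ α/n`.
    have hgap : ∑ x, ((D x : ℝ) / n) * r x - ∑ x, p x * r x ≤ -(α / n) := by
      rw [le_neg, div_le_iff₀ hn0]
      have hD' := hDdot Q
      by_cases hlt : y < n * Q.dot p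
      · have hrx : ∀ x, r x = Q x := fun x => by rw [hr, mwPenalty, if_pos hlt]
        simp only [hrx]
        rw [← heval'] at hlt
        rw [abs_of_neg (by linarith), heval] at hT
        have := (abs_le.1 hy).1
        linarith
      · have hrx : ∀ x, r x = 1 - Q x := fun x => by rw [hr, mwPenalty, if_neg hlt]
        simp only [hrx, mul_sub, mul_one, Finset.sum_sub_distrib, hq1, hp1]
        rw [← heval'] at hlt
        rw [abs_of_nonneg (by linarith), heval] at hT
        have := (abs_le.1 hy).2
        linarith
    have hη : 0 ≤ α / (2 * n) := by positivity
    have hpot := mwWeight_potential hη hr0 hr1 hp hp1 hq1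
    have hW0 : 0 < ∑ x, mwWeight (α / (2 * n)) r p x := sum_mwWeight_pos hp hp1
    rw [mwRule_update]
    refine ⟨fun x => div_pos (mul_pos (Real.exp_pos _) (hp x)) hW0, ?_, ?_⟩
    · rw [← Finset.sum_div, div_self hW0.ne']
    · have h1 := mul_le_mul_of_nonneg_left hgap hη
      -- With `η = α/(2n)` the gain `α²/(2n²)` exceeds the second-order loss `α²/(8n²)`.
      have h2 : α / (2 * n) * -(α / n) + (α / (2 * n)) ^ 2 / 2 =
          -(3 * α ^ 2 / (8 * (n : ℝ) ^ 2)) := by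
        field_simp
        ring
      push_cast
      linarith
  · intro p c _ Q _ h
    exact h.trans hTa

end MultiplicativeWeights

/-! ### Choice of `α` for multiplicative weights. -/

lemma log_two_mul_div_le {k : ℕ} {β : ℝ} (h : 2 ≤ k / β) :
    Real.log (2 * k / β) ≤ 2 * Real.log (k / β) := by
  have h0 : (0 : ℝ) < k / β := by linarith
  have := Real.log_le_log (by norm_num) h
  rw [mul_div_assoc, Real.log_mul (by norm_num) h0.ne']
  linarith

lemma sqrt_le_error_scale {A c n x y ε : ℝ} (hc : 0 ≤ c) (hn : 0 ≤ n) (hx : 0 ≤ x) (hy : 0 ≤ y)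
    (h : A ≤ c ^ 2 * (n * √x * y / ε)) :
    √A ≤ c * (√n * x ^ (1 / 4 : ℝ) * √y / √ε) := by
  have h1 := Real.sqrt_le_sqrt h
  have h2 : √(√x) = x ^ (1 / 4 : ℝ) := by
    rw [Real.sqrt_eq_rpow, Real.sqrt_eq_rpow, ← Real.rpow_mul hx]
    norm_num
  rwa [Real.sqrt_mul (sq_nonneg c), Real.sqrt_sq hc, Real.sqrt_div (by positivity),
    Real.sqrt_mul (by positivity), Real.sqrt_mul hn, h2] at h1

lemma mwRule_release {X : Type u} [Fintype X] {n k : ℕ} {ε δ β : ℝ} (hX : 2 ≤ Fintype.card X)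
    (hn : 1 ≤ n) (hε : 0 < ε) (hε1 : ε ≤ 1) (hδ : 0 < δ) (hδ1 : δ ≤ 1) (hβ : 0 < β) (hβ1 : β ≤ 1)
    (hkβ : 2 ≤ k / β) :
    ∃ α : ℝ, 0 < α ∧
      ReleaseIsPrivate.{v} (mwRule X n α) (mwBudget X n α) ε δ β k ∧
      ReleaseIsAccurate.{v} (mwRule X n α) (mwBudget X n α) ε δ β k n
        (225 * (√n * Real.log (Fintype.card X) ^ (1 / 4 : ℝ) *
          √(Real.log (4 / δ) * Real.log (k / β)) / √ε)) := by
  have hn0 : (0 : ℝ) < n := by exact_mod_cast hn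
  have hk : 1 ≤ k := by
    rcases Nat.eq_zero_or_pos k with h | h
    · rw [h] at hkβ; norm_num at hkβ
    · exact h
  have hX0 : (2 : ℝ) ≤ Fintype.card X := by exact_mod_cast hX
  set ℓ := Real.log (Fintype.card X) with hℓ
  have hℓ2 : 0.69 ≤ ℓ :=
    (by linarith [Real.log_two_gt_d9] : 0.69 ≤ Real.log 2).trans
      (Real.log_le_log (by norm_num) hX0)
  have hsℓ : 0.8 ≤ √ℓ := Real.le_sqrt_of_sq_le (by norm_num; linarith)
  set L := Real.log (4 / δ) with hL
  have hL1 : 1 < L := one_lt_log_four_div hδ hδ1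
  set Λ := Real.log (k / β) with hΛ
  have hΛ0 : 0 < Λ := Real.log_pos (by linarith)
  set Λ' := Real.log (2 * k / β) with hΛ'
  have hΛΛ' : Λ' ≤ 2 * Λ := log_two_mul_div_le hkβ
  have hΛ'0 : 0 < Λ' := Real.log_pos (by rw [mul_div_assoc]; linarith)
  set W := 8000 * n * √ℓ * L * Λ' / ε with hW
  have hW0 : 0 < W := by positivity
  set α₀ := √(W / 2) with hα₀
  have hα₀0 : 0 < α₀ := Real.sqrt_pos.2 (by positivity)
  have hα₀2 : α₀ ^ 2 = W / 2 := Real.sq_sqrt (by positivity)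
  -- Uncapped, `T = W/α₀ = 2α₀`, so the error `5T/4` is `2.5α₀`; the constant is `225 = 2.5 · 90`
  -- with `8000 ≤ 90²`. The cap makes the budget at least `4`.
  set α := min α₀ (n * √ℓ) with hα
  have hα0 : 0 < α := lt_min hα₀0 (by positivity)
  have hB : 1 ≤ mwBudget X n α := by
    have h1 : α ^ 2 ≤ (n * √ℓ) ^ 2 := pow_le_pow_left₀ hα0.le (min_le_right _ _) 2
    rw [mul_pow, Real.sq_sqrt (by linarith)] at h1
    rw [mwBudget, le_div_iff₀ (by positivity), ← hℓ]
    nlinarith [mul_pos (pow_pos hn0 2) (by linarith : 0 < ℓ)]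
  have hT : updateThreshold (mwBudget X n α) ε δ β k = W / α := by
    have h1 : √(mwBudget X n α) = 2 * n * √ℓ / α := by
      have : mwBudget X n α = (2 * n * √ℓ / α) ^ 2 := by
        rw [mwBudget, div_pow, mul_pow, mul_pow, Real.sq_sqrt (by linarith), ← hℓ]
        norm_num
      rw [this, Real.sqrt_sq (by positivity)]
    rw [updateThreshold, noiseScale, h1, ← hL, ← hΛ', hW]
    field_simp
    norm_num
  have hK : 2.5 * α₀ ≤ 225 * (√n * ℓ ^ (1 / 4 : ℝ) * √(L * Λ) / √ε) := by
    have h1 : W / 2 ≤ 90 ^ 2 * (n * √ℓ * (L * Λ) / ε) := by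
      calc W / 2 = 4000 * (n * √ℓ * (L * Λ') / ε) := by rw [hW]; ring
        _ ≤ 4000 * (n * √ℓ * (L * (2 * Λ)) / ε) := by gcongr
        _ = 8000 * (n * √ℓ * (L * Λ) / ε) := by ring
        _ ≤ _ := by gcongr; norm_num
    have h2 := sqrt_le_error_scale (by norm_num) hn0.le (by linarith) (by positivity) h1
    linarith
  refine ⟨α, hα0, releaseIsPrivate (mwRule_isMeasurable n α) hB hε hε1 hδ hδ1 β k,
    releaseIsAccurate (by linarith) hε hδ hδ1 hβ hβ1 hk fun D hD Qs => ?_⟩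
  rw [hT]
  have hαW : α * α ≤ W / 2 := by
    rw [← hα₀2, sq]
    exact mul_self_le_mul_self hα0.le (min_le_left _ _)
  rcases le_total α₀ (n * √ℓ) with h | h
  · have hαα : α = α₀ := min_eq_left h
    have hTα : W / α = 2 * α₀ := by
      rw [hαα, div_eq_iff hα₀0.ne']
      linarith
    rw [hTα]
    exact ⟨_, mwInvariant_accuracy hD hn hX hα0 (by linarith) (by linarith) _⟩
  -- Capped case: `n ≤ α/0.8` and `T ≥ 2α`, so `n ≤ 3T/4` and no update can occur.
  · have hαα : α = n * √ℓ := min_eq_right h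
    have hTα : 2 * α ≤ W / α := by
      rw [le_div_iff₀ hα0]
      linarith
    have hnα : 0.8 * n ≤ α := by
      rw [hαα]
      nlinarith
    refine ⟨_, AccuracyInvariant.of_le hD (by linarith) (by linarith) ?_ (fun Q => ?_) _⟩
    · have : α ≤ α₀ := min_le_left _ _
      linarith
    · have hp : ∀ x, 0 ≤ (mwRule X n α).init x := fun x => by simp only [mwRule]; positivity
      have h1 : ∑ x, (mwRule X n α).init x = 1 := by
        simp only [mwRule, Finset.sum_const, Finset.card_univ, nsmul_eq_mul]
        field_simp
      have h2 := Q.dot_nonneg hp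
      have h3 := Q.dot_le hp
      rw [h1] at h3
      exact ⟨mul_nonneg hn0.le h2, mul_le_of_le_one_right hn0.le h3⟩

/-! ### Medians -/

section Median

variable {ι : Type*}

open Classical in
/-- The lower median of the values `f i`, `i ∈ s`. -/
noncomputable def lowerMedian (s : Finset ι) (f : ι → ℝ) : ℝ :=
  sInf {v : ℝ | s.card ≤ 2 * (s.filter fun i => f i ≤ v).card}

/-- Negation exchanges lower and upper medians, so facts about lower medians suffice. -/
lemma median_eq (s : Finset ι) (f : ι → ℝ) :
    median s f = (lowerMedian s f - lowerMedian s fun i => -f i) / 2 := by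
  classical
  have : {v : ℝ | s.card ≤ 2 * (s.filter fun i => -f i ≤ v).card} =
      -{v : ℝ | s.card ≤ 2 * (s.filter fun i => v ≤ f i).card} := by
    ext v
    simp only [Set.mem_ofPred_eq, Set.mem_neg, neg_le]
  rw [median, lowerMedian, lowerMedian, this, Real.sInf_neg, sub_neg_eq_add]

open Classical in
/-- A value that has half of the family below it is at least some value of the family with the
same property. -/
lemma exists_mem_half_le {s : Finset ι} (hs : s.Nonempty) {f : ι → ℝ} {v : ℝ}
    (hv : s.card ≤ 2 * (s.filter fun i => f i ≤ v).card) :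
    ∃ j ∈ s, f j ≤ v ∧ s.card ≤ 2 * (s.filter fun i => f i ≤ f j).card := by
  have hne : (s.filter fun i => f i ≤ v).Nonempty := by
    rw [← Finset.card_pos]
    have := hs.card_pos
    omega
  obtain ⟨j, hj, hmax⟩ := Finset.exists_max_image _ f hne
  have hj' := Finset.mem_filter.1 hj
  refine ⟨j, hj'.1, hj'.2, hv.trans (Nat.mul_le_mul_left 2 (Finset.card_le_card fun i hi => ?_))⟩
  exact Finset.mem_filter.2 ⟨(Finset.mem_filter.1 hi).1, hmax i hi⟩

open Classical in
lemma isLeast_lowerMedian {s : Finset ι} (hs : s.Nonempty) (f : ι → ℝ) :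
    IsLeast {v : ℝ | s.card ≤ 2 * (s.filter fun i => f i ≤ v).card} (lowerMedian s f) := by
  set t := s.filter fun j => s.card ≤ 2 * (s.filter fun i => f i ≤ f j).card with ht
  obtain ⟨m, hm, hmax⟩ := Finset.exists_max_image s f hs
  have hne : t.Nonempty := by
    refine ⟨m, Finset.mem_filter.2 ⟨hm, ?_⟩⟩
    rw [Finset.filter_true_of_mem hmax]
    omega
  obtain ⟨j, hj, hmin⟩ := Finset.exists_min_image t f hne
  have hleast : IsLeast {v : ℝ | s.card ≤ 2 * (s.filter fun i => f i ≤ v).card} (f j) := by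
    refine ⟨(Finset.mem_filter.1 hj).2, fun v hv => ?_⟩
    obtain ⟨l, hl, hlv, hl2⟩ := exists_mem_half_le hs hv
    exact (hmin l (Finset.mem_filter.2 ⟨hl, hl2⟩)).trans hlv
  have : lowerMedian s f = f j := by
    rw [lowerMedian]
    convert hleast.csInf_eq
  rw [this]
  exact hleast

open Classical in
-- The strict form reduces measurability of the lower median to counting the events `f i < c`.
lemma lowerMedian_lt_iff {s : Finset ι} (hs : s.Nonempty) (f : ι → ℝ) (c : ℝ) :
    lowerMedian s f < c ↔ s.card ≤ 2 * (s.filter fun i => f i < c).card := by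
  have hL := isLeast_lowerMedian hs f
  constructor
  · intro h
    refine hL.1.trans (Nat.mul_le_mul_left 2 (Finset.card_le_card fun i hi => ?_))
    have hi := Finset.mem_filter.1 hi
    exact Finset.mem_filter.2 ⟨hi.1, hi.2.trans_lt h⟩
  · intro h
    have hne : (s.filter fun i => f i < c).Nonempty := by
      rw [← Finset.card_pos]
      have := hs.card_pos
      omega
    obtain ⟨j, hj, hmax⟩ := Finset.exists_max_image _ f hne
    refine (hL.2 (?_ : f j ∈ _)).trans_lt (Finset.mem_filter.1 hj).2
    refine h.trans (Nat.mul_le_mul_left 2 (Finset.card_le_card fun i hi => ?_))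
    exact Finset.mem_filter.2 ⟨(Finset.mem_filter.1 hi).1, hmax i hi⟩

open Classical in
lemma lowerMedian_le_upper {s : Finset ι} (hs : s.Nonempty) (f : ι → ℝ) :
    lowerMedian s f ≤ -lowerMedian s fun i => -f i := by
  rw [le_neg]
  refine (isLeast_lowerMedian hs fun i => -f i).2 ?_
  have h := (lowerMedian_lt_iff hs f (lowerMedian s f)).not.1 (lt_irrefl _)
  have h2 := Finset.card_filter_add_card_filter_not (s := s) fun i => f i < lowerMedian s f
  simp only [not_lt] at h2
  simp only [Set.mem_ofPred_eq, neg_le_neg_iff]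
  omega

open Classical in
lemma card_le_two_mul_le_median {s : Finset ι} (hs : s.Nonempty) (f : ι → ℝ) :
    s.card ≤ 2 * (s.filter fun i => f i ≤ median s f).card := by
  refine (isLeast_lowerMedian hs f).1.trans
    (Nat.mul_le_mul_left 2 (Finset.card_le_card fun i hi => ?_))
  have hi := Finset.mem_filter.1 hi
  refine Finset.mem_filter.2 ⟨hi.1, hi.2.trans ?_⟩
  have := lowerMedian_le_upper hs f
  rw [median_eq]
  linarith

open Classical in
lemma card_le_two_mul_median_le {s : Finset ι} (hs : s.Nonempty) (f : ι → ℝ) :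
    s.card ≤ 2 * (s.filter fun i => median s f ≤ f i).card := by
  refine (isLeast_lowerMedian hs fun i => -f i).1.trans
    (Nat.mul_le_mul_left 2 (Finset.card_le_card fun i hi => ?_))
  have hi := Finset.mem_filter.1 hi
  refine Finset.mem_filter.2 ⟨hi.1, ?_⟩
  have := lowerMedian_le_upper hs f
  rw [median_eq]
  linarith [hi.2]

lemma median_mem {s : Finset ι} (hs : s.Nonempty) {f : ι → ℝ} {b : ℝ}
    (hf : ∀ i ∈ s, 0 ≤ f i ∧ f i ≤ b) : 0 ≤ median s f ∧ median s f ≤ b := by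
  classical
  have hpos := hs.card_pos
  constructor
  · have h := card_le_two_mul_le_median hs f
    obtain ⟨i, hi⟩ : (s.filter fun i => f i ≤ median s f).Nonempty := by
      rw [← Finset.card_pos]; omega
    have hi := Finset.mem_filter.1 hi
    exact (hf i hi.1).1.trans hi.2
  · have h := card_le_two_mul_median_le hs f
    obtain ⟨i, hi⟩ : (s.filter fun i => median s f ≤ f i).Nonempty := by
      rw [← Finset.card_pos]; omega
    have hi := Finset.mem_filter.1 hi
    exact hi.2.trans (hf i hi.1).2

lemma measurable_lowerMedian {Z : Type*} [MeasurableSpace Z] (s : Finset ι) {f : Z → ι → ℝ}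
    (hf : ∀ i, Measurable fun z => f z i) : Measurable fun z => lowerMedian s (f z) := by
  classical
  rcases s.eq_empty_or_nonempty with rfl | hs
  -- For the empty family every `v` qualifies, so the infimum is a fixed default value.
  · simp only [lowerMedian, Finset.card_empty, Nat.zero_le]
    exact measurable_const
  refine measurable_of_Iio fun c => ?_
  have h : (fun z => lowerMedian s (f z)) ⁻¹' Set.Iio c =
      {z | s.card ≤ 2 * ∑ i ∈ s, if f z i < c then 1 else 0} := by
    ext z
    simp only [Set.mem_preimage, Set.mem_Iio, lowerMedian_lt_iff hs, Finset.card_filter,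
      Set.mem_ofPred_eq]
  rw [h]
  refine measurableSet_le measurable_const (measurable_const.mul
    (Finset.measurable_fun_sum _ fun i _ => Measurable.ite
      (measurableSet_lt (hf i) measurable_const) measurable_const measurable_const))

lemma measurable_median {Z : Type*} [MeasurableSpace Z] (s : Finset ι) {f : Z → ι → ℝ}
    (hf : ∀ i, Measurable fun z => f z i) : Measurable fun z => median s (f z) := by
  simp only [median_eq]
  exact ((measurable_lowerMedian s hf).sub
    (measurable_lowerMedian s fun i => (hf i).neg)).div_const 2

end Median

/-! ### The median mechanism -/

section MedianMechanism

variable {X : Type*} [Fintype X]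

instance Database.instMeasurableSpaceFinset : MeasurableSpace (Finset (Database X)) := ⊤

lemma LinearQuery.measurable_rescaled (n : ℕ) (E : Database X) :
    Measurable fun Q : LinearQuery X => Q.rescaled n E :=
  ((LinearQuery.measurable_onDatabase E).div_const _).const_mul _

lemma measurable_finset_filter {Z : Type*} [MeasurableSpace Z] (S : Finset (Database X))
    {P : Z → Database X → Prop} [∀ z, DecidablePred (P z)] (hP : ∀ E, MeasurableSet {z | P z E}) :
    Measurable fun z => S.filter (P z) := by
  refine measurable_to_countable' fun S' => ?_
  have : (fun z => S.filter (P z)) ⁻¹' {S'} = ⋂ E, {z | (E ∈ S ∧ P z E) ↔ E ∈ S'} := by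
    ext z
    simp [Finset.ext_iff]
  rw [this]
  refine MeasurableSet.iInter fun E => ?_
  exact ((MeasurableSet.const _).inter (hP E)).iff (MeasurableSet.const _)

lemma medianRule_isMeasurable (n k : ℕ) (α : ℝ) : (medianRule X n k α).IsMeasurable where
  measurable_eval := by
    refine measurable_from_prod_countable_left fun S => ?_
    exact measurable_median S fun E => LinearQuery.measurable_rescaled n E
  measurable_update := by
    refine measurable_from_prod_countable_right fun S => ?_
    have hy : Measurable fun p : LinearQuery X × ℝ => p.2 := measurable_snd
    have hE : ∀ E, Measurable fun p : LinearQuery X × ℝ => p.1.rescaled n E := fun E =>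
      (LinearQuery.measurable_rescaled n E).comp measurable_fst
    have hm : Measurable fun p : LinearQuery X × ℝ => median S (LinearQuery.rescaled n p.1) :=
      measurable_median S hE
    refine Measurable.ite (MeasurableSet.const (S = ∅)) measurable_const ?_
    refine Measurable.ite (measurableSet_lt hy hm)
      (measurable_finset_filter S fun E => (measurableSet_le hm (hE E)).compl) ?_
    exact Measurable.ite (measurableSet_lt hm hy)
      (measurable_finset_filter S fun E => (measurableSet_le (hE E) hm).compl) measurable_const

/-- The histogram of a list of elements of the universe. -/
def histogram [DecidableEq X] {m : ℕ} (x : Fin m → X) : Database X :=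
  fun y => (Finset.univ.filter fun i => x i = y).card

lemma LinearQuery.onDatabase_histogram [DecidableEq X] {m : ℕ} (Q : LinearQuery X)
    (x : Fin m → X) : Q.onDatabase (histogram x) = ∑ i, (Q (x i) : ℝ) := by
  unfold LinearQuery.onDatabase LinearQuery.dot histogram
  rw [← Finset.sum_fiberwise Finset.univ x]
  refine Finset.sum_congr rfl fun y _ => ?_
  rw [Finset.sum_congr rfl (g := fun _ => (Q y : ℝ))
    (fun i hi => by rw [(Finset.mem_filter.1 hi).2])]
  simp [mul_comm]

lemma size_histogram [DecidableEq X] {m : ℕ} (x : Fin m → X) : (histogram x).size = m := by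
  unfold Database.size histogram
  rw [← Finset.card_eq_sum_card_fiberwise fun i _ => Finset.mem_univ (x i)]
  simp

lemma exists_histogram_eq [DecidableEq X] {m : ℕ} {E : Database X} (hE : E.size = m) :
    ∃ x : Fin m → X, histogram x = E := by
  let e : (Σ y, Fin (E y)) ≃ Fin m := Fintype.equivFinOfCardEq (by
    rw [Fintype.card_sigma]; simpa [Database.size] using hE)
  refine ⟨fun i => (e.symm i).1, funext fun y => ?_⟩
  unfold histogram
  rw [← Fintype.card_subtype]
  rw [Fintype.card_congr (e.symm.subtypeEquiv (q := fun p : Σ y, Fin (E y) => p.1 = y)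
    fun i => Iff.rfl), Fintype.card_congr (Equiv.sigmaSubtype (β := fun y => Fin (E y)) y)]
  simp

/-- Histograms are images of sequences, and swapping two distinct entries shows that the map is not
injective. Strictness is what keeps the number of halvings strictly below the budget. -/
lemma card_databases_lt {m : ℕ} (hm : 2 ≤ m) (hX : 2 ≤ Fintype.card X) [DecidableEq X] :
    (Finset.piAntidiag (Finset.univ : Finset X) m).card < Fintype.card X ^ m := by
  have h1 : Finset.piAntidiag (Finset.univ : Finset X) m =
      Finset.univ.image (histogram : (Fin m → X) → Database X) := by
    ext E
    simp only [Finset.mem_piAntidiag, Finset.mem_image, Finset.mem_univ, true_and, implies_true,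
      and_true]
    constructor
    · exact fun h => exists_histogram_eq h
    · rintro ⟨x, rfl⟩
      exact size_histogram x
  have h2 : Fintype.card X ^ m = (Finset.univ : Finset (Fin m → X)).card := by simp
  rw [h1, h2]
  refine lt_of_le_of_ne Finset.card_image_le fun h => ?_
  have hinj := Finset.card_image_iff.1 h
  obtain ⟨a, b, hab⟩ := Fintype.exists_pair_of_one_lt_card (α := X) (by omega)
  let i : Fin m := ⟨0, by omega⟩
  let j : Fin m := ⟨1, by omega⟩
  have hij : i ≠ j := by simp [i, j]
  let x : Fin m → X := Function.update (fun _ => a) i b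
  have h3 : histogram (x ∘ Equiv.swap i j) = histogram x := by
    funext y
    unfold histogram
    refine Finset.card_bij (fun l _ => Equiv.swap i j l) (fun l hl => by simpa using hl)
      (fun _ _ _ _ h => (Equiv.swap i j).injective h)
      (fun l hl => ⟨Equiv.swap i j l, by simpa using hl, by simp⟩)
  have h4 := congrFun (hinj (Finset.mem_coe.2 (Finset.mem_univ _)) (Finset.mem_coe.2 (Finset.mem_univ _)) h3) i
  simp [x, hij.symm] at h4
  exact hab h4

/-- A Hoeffding-type bound for the moment generating function. -/
lemma sum_mul_exp_le {q f : X → ℝ} (hq : ∀ x, 0 ≤ q x) (hq1 : ∑ x, q x = 1)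
    (hf : ∑ x, q x * f x = 0) (hf1 : ∀ x, |f x| ≤ 1) {c : ℝ} (hc : |c| ≤ 1) :
    ∑ x, q x * Real.exp (c * f x) ≤ Real.exp (c ^ 2) := by
  have h1 : ∀ x, q x * Real.exp (c * f x) ≤ q x + c * (q x * f x) + q x * c ^ 2 := by
    intro x
    have h2 : |c * f x| ≤ 1 := by
      rw [abs_mul]
      exact mul_le_one₀ hc (abs_nonneg _) (hf1 x)
    have h3 := exp_le_one_add_add_sq h2
    have h4 : (c * f x) ^ 2 ≤ c ^ 2 := by
      rw [mul_pow]
      refine mul_le_of_le_one_right (sq_nonneg c) ?_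
      rw [← sq_abs]
      exact pow_le_one₀ (abs_nonneg _) (hf1 x)
    calc q x * Real.exp (c * f x) ≤ q x * (1 + c * f x + c ^ 2) :=
          mul_le_mul_of_nonneg_left (by linarith) (hq x)
      _ = _ := by ring
  refine (Finset.sum_le_sum fun x _ => h1 x).trans ?_
  rw [Finset.sum_add_distrib, Finset.sum_add_distrib, ← Finset.mul_sum, ← Finset.sum_mul, hf, hq1]
  linarith [Real.add_one_le_exp (c ^ 2)]

lemma sum_prod_mul_exp (q f : X → ℝ) (c : ℝ) (m : ℕ) [DecidableEq X] :
    ∑ x : Fin m → X, (∏ i, q (x i)) * Real.exp (c * ∑ i, f (x i)) =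
      (∑ y, q y * Real.exp (c * f y)) ^ m := by
  have h := Finset.prod_univ_sum (fun _ : Fin m => (Finset.univ : Finset X))
    fun _ y => q y * Real.exp (c * f y)
  rw [Finset.prod_const, Finset.card_univ, Fintype.card_fin, Fintype.piFinset_univ] at h
  rw [h]
  refine Finset.sum_congr rfl fun x _ => ?_
  rw [Finset.prod_mul_distrib, ← Real.exp_sum, Finset.mul_sum]

/-- Sampling: a probability vector is approximated by the uniform distribution on a multiset,
simultaneously for few queries. -/
lemma exists_sample [DecidableEq X] {k m : ℕ} {τ : ℝ} {q : X → ℝ} (hq : ∀ x, 0 ≤ q x)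
    (hq1 : ∑ x, q x = 1) (Qs : Fin k → LinearQuery X) (hτ : 0 ≤ τ) (hτ2 : τ ≤ 2)
    (hkm : 2 * k < Real.exp (m * τ ^ 2 / 4)) :
    ∃ x : Fin m → X, ∀ j, |∑ i, ((Qs j (x i) : ℝ) - (Qs j).dot q)| ≤ m * τ := by
  by_contra! hcon
  have hdot : ∀ Q : LinearQuery X, ∑ x, q x * ((Q x : ℝ) - Q.dot q) = 0 := fun Q => by
    simp only [mul_sub, Finset.sum_sub_distrib, ← Finset.sum_mul, hq1, one_mul]
    rw [LinearQuery.dot, sub_eq_zero]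
    exact Finset.sum_congr rfl fun x _ => mul_comm _ _
  have habs : ∀ (Q : LinearQuery X) x, |(Q x : ℝ) - Q.dot q| ≤ 1 := fun Q x => by
    have h1 := Q.dot_nonneg hq
    have h2 := Q.dot_le hq
    rw [hq1] at h2
    exact abs_le.2 ⟨by linarith [(Q x).2.1], by linarith [(Q x).2.2]⟩
  have hc : |τ / 2| ≤ 1 := by rw [abs_of_nonneg (by linarith)]; linarith
  have hc' : |-(τ / 2)| ≤ 1 := by rwa [abs_neg]
  set F : LinearQuery X → (Fin m → X) → ℝ := fun Q x => ∑ i, ((Q (x i) : ℝ) - Q.dot q) with hF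
  have htot : ∑ x : Fin m → X, ∏ i, q (x i) = 1 := by
    have := sum_prod_mul_exp q (fun _ => 0) 0 m
    simpa [hq1] using this
  -- Chernoff's method for `m` independent samples from `q`, with exponent `τ/2`: the expected sum
  -- of exponentials is at most `2k e^{mτ²/4}`, yet if every sample failed it would be at least
  -- `e^{mτ²/2}`.
  have hupper : ∑ x : Fin m → X, (∏ i, q (x i)) *
      ∑ j, (Real.exp (τ / 2 * F (Qs j) x) + Real.exp (-(τ / 2) * F (Qs j) x)) ≤
      2 * k * Real.exp (m * τ ^ 2 / 4) := by
    have h1 : ∀ c : ℝ, |c| ≤ 1 → c ^ 2 = τ ^ 2 / 4 → ∀ j,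
        ∑ x : Fin m → X, (∏ i, q (x i)) * Real.exp (c * F (Qs j) x) ≤
          Real.exp (m * τ ^ 2 / 4) := by
      intro c hc hc2 j
      rw [sum_prod_mul_exp q (fun y => (Qs j y : ℝ) - (Qs j).dot q) c m]
      have h2 := sum_mul_exp_le hq hq1 (hdot (Qs j)) (habs (Qs j)) hc
      have h3 := pow_le_pow_left₀ (Finset.sum_nonneg fun y _ =>
        mul_nonneg (hq y) (Real.exp_pos _).le) h2 m
      rw [← Real.exp_nat_mul, hc2] at h3
      rwa [mul_div_assoc]
    simp only [Finset.mul_sum, mul_add]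
    rw [Finset.sum_comm]
    refine (Finset.sum_le_card_nsmul _ _ (2 * Real.exp (m * τ ^ 2 / 4)) fun j _ => ?_).trans ?_
    · rw [Finset.sum_add_distrib]
      have h2 := h1 _ hc (by ring) j
      have h3 := h1 _ hc' (by ring) j
      linarith
    · simp only [Finset.card_univ, Fintype.card_fin, nsmul_eq_mul]
      linarith
  have hlower : Real.exp (m * τ ^ 2 / 2) ≤ ∑ x : Fin m → X, (∏ i, q (x i)) *
      ∑ j, (Real.exp (τ / 2 * F (Qs j) x) + Real.exp (-(τ / 2) * F (Qs j) x)) := by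
    rw [← one_mul (Real.exp (m * τ ^ 2 / 2)), ← htot, Finset.sum_mul]
    refine Finset.sum_le_sum fun x _ => mul_le_mul_of_nonneg_left ?_
      (Finset.prod_nonneg fun i _ => hq _)
    obtain ⟨j, hj⟩ := hcon x
    refine le_trans ?_ (Finset.single_le_sum (f := fun j =>
      Real.exp (τ / 2 * F (Qs j) x) + Real.exp (-(τ / 2) * F (Qs j) x))
      (fun j _ => by positivity) (Finset.mem_univ j))
    have hj' : m * τ < |F (Qs j) x| := hj
    have h1 : Real.exp (m * τ ^ 2 / 2) ≤ Real.exp (τ / 2 * |F (Qs j) x|) := by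
      refine Real.exp_le_exp.2 ?_
      have := mul_le_mul_of_nonneg_left hj'.le (by linarith : 0 ≤ τ / 2)
      linarith
    refine h1.trans ?_
    rcases abs_cases (F (Qs j) x) with ⟨h, _⟩ | ⟨h, _⟩
    · rw [h]
      linarith [Real.exp_pos (-(τ / 2) * F (Qs j) x)]
    · rw [h, mul_neg, ← neg_mul]
      linarith [Real.exp_pos (τ / 2 * F (Qs j) x)]
  have h1 := hlower.trans hupper
  have h2 : Real.exp (m * τ ^ 2 / 2) = Real.exp (m * τ ^ 2 / 4) * Real.exp (m * τ ^ 2 / 4) := by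
    rw [← Real.exp_add]
    congr 1
    ring
  rw [h2] at h1
  exact absurd (le_of_mul_le_mul_right h1 (Real.exp_pos _)) (not_le.2 hkm)

lemma LinearQuery.rescaled_mem (n : ℕ) (Q : LinearQuery X) (E : Database X) :
    0 ≤ Q.rescaled n E ∧ Q.rescaled n E ≤ n := by
  have h := Q.onDatabase_mem E
  refine ⟨mul_nonneg (Nat.cast_nonneg n) (div_nonneg h.1 (Nat.cast_nonneg _)),
    mul_le_of_le_one_right (Nat.cast_nonneg n) ?_⟩
  exact div_le_one_of_le₀ h.2 (Nat.cast_nonneg _)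

/-- Some database of size `m` approximates `D` on all queries of a short list. -/
lemma exists_rescaled_approx [DecidableEq X] {k m n : ℕ} {τ : ℝ} (hn : 1 ≤ n) (hm : 1 ≤ m)
    {D : Database X} (hD : D.size = n) (Qs : Fin k → LinearQuery X) (hτ : 0 ≤ τ) (hτ2 : τ ≤ 2)
    (hkm : 2 * k < Real.exp (m * τ ^ 2 / 4)) :
    ∃ E : Database X, E.size = m ∧ ∀ Q ∈ Set.range Qs,
      |Q.rescaled n E - Q.onDatabase D| ≤ n * τ := by
  have hn0 : (0 : ℝ) < n := by exact_mod_cast hn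
  have hm0 : (0 : ℝ) < m := by exact_mod_cast hm
  obtain ⟨x, hx⟩ := exists_sample (q := fun x => (n : ℝ)⁻¹ * D x) (fun x => by positivity)
    (by rw [← Finset.mul_sum, D.sum_cast, hD, inv_mul_cancel₀ hn0.ne']) Qs hτ hτ2 hkm
  refine ⟨histogram x, size_histogram x, ?_⟩
  rintro _ ⟨j, rfl⟩
  have h := hx j
  rw [Finset.sum_sub_distrib, Finset.sum_const, Finset.card_univ, Fintype.card_fin, nsmul_eq_mul,
    LinearQuery.dot_const_mul, ← LinearQuery.onDatabase_histogram] at h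
  rw [LinearQuery.rescaled, size_histogram]
  have h1 : n * ((Qs j).onDatabase (histogram x) / m) - (Qs j).onDatabase D =
      n / m * ((Qs j).onDatabase (histogram x) -
        m * ((n : ℝ)⁻¹ * (Qs j).dot fun x => (D x : ℝ))) := by
    rw [LinearQuery.onDatabase, LinearQuery.onDatabase]
    field_simp
  rw [h1, abs_mul, abs_of_pos (by positivity)]
  refine (mul_le_mul_of_nonneg_left h (by positivity)).trans (le_of_eq ?_)
  field_simp

/-- At an update the true answer lies more than `3T/4 ≥ b` beyond the median, so `E` lies strictly
on the side that is kept. At least half of the collection is removed, and since `E` remains, `2^c <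
|X|^m`. -/
lemma medianInvariant_accuracy [DecidableEq X] {n k : ℕ} {α b T a : ℝ} {D E : Database X}
    {𝒬 : Set (LinearQuery X)} (hX : 2 ≤ Fintype.card X) (hm : 2 ≤ medianDbSize n k α)
    (hE : E.size = medianDbSize n k α) (hED : ∀ Q ∈ 𝒬, |Q.rescaled n E - Q.onDatabase D| ≤ b)
    (hT : 0 < T) (hbT : b ≤ 3 * T / 4) (hTa : 5 * T / 4 ≤ a) :
    AccuracyInvariant (medianRule X n k α) (medianBudget X n k α) T D 𝒬 a
      (fun S c => E ∈ S ∧ S.card * 2 ^ c < Fintype.card X ^ medianDbSize n k α) := by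
  refine ⟨⟨?_, ?_⟩, ?_, ?_, fun S c _ Q _ h => h.trans hTa⟩
  · simp only [medianRule, Finset.mem_piAntidiag, Finset.mem_univ, implies_true, and_true]
    exact hE
  · simp only [medianRule, pow_zero, mul_one]
    convert card_databases_lt hm hX
  · rintro S c ⟨hS, hc⟩
    have hpos := Finset.card_pos.2 ⟨E, hS⟩
    have h1 : 2 ^ c < Fintype.card X ^ medianDbSize n k α :=
      (Nat.le_mul_of_pos_left _ hpos).trans_lt hc
    have h2 : (2 : ℝ) ^ c < (Fintype.card X : ℝ) ^ medianDbSize n k α := by exact_mod_cast h1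
    have h3 := Real.log_lt_log (by positivity) h2
    rw [Real.log_pow, Real.log_pow] at h3
    rw [medianBudget, Real.logb, mul_div_assoc', lt_div_iff₀ (Real.log_pos (by norm_num))]
    exact h3
  · rintro S c ⟨hS, hc⟩ Q hQ y hy1 hy2
    refine ⟨?_, by linarith⟩
    have hSne : S.Nonempty := ⟨E, hS⟩
    have hy2 := abs_le.1 hy2
    have hEQ := abs_le.1 (hED Q hQ)
    have heval : (medianRule X n k α).eval Q S = median S (LinearQuery.rescaled n Q) := rfl
    rw [heval] at hy1
    simp only [medianRule]
    rw [if_neg hSne.ne_empty]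
    set M := median S (LinearQuery.rescaled n Q) with hM
    have hhalf : ∀ S' : Finset (Database X), 2 * S'.card ≤ S.card →
        S'.card * 2 ^ (c + 1) < Fintype.card X ^ medianDbSize n k α := fun S' h => by
      refine lt_of_le_of_lt ?_ hc
      rw [pow_succ, mul_comm (2 ^ c), ← mul_assoc, mul_comm S'.card]
      exact Nat.mul_le_mul_right _ h
    by_cases hlt : y < M
    · rw [if_pos hlt]
      rw [abs_of_neg (by linarith)] at hy1
      refine ⟨Finset.mem_filter.2 ⟨hS, ?_⟩, hhalf _ ?_⟩
      · rw [not_le]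
        linarith
      · have h1 := card_le_two_mul_median_le hSne (LinearQuery.rescaled n Q)
        have h2 := Finset.card_filter_add_card_filter_not (s := S)
          fun E => M ≤ LinearQuery.rescaled n Q E
        rw [← hM] at h1
        omega
    · have hgt : M < y := by
        rw [abs_of_nonneg (by linarith)] at hy1
        linarith
      rw [if_neg hlt, if_pos hgt]
      rw [abs_of_pos (by linarith)] at hy1
      refine ⟨Finset.mem_filter.2 ⟨hS, ?_⟩, hhalf _ ?_⟩
      · rw [not_le]
        linarith
      · have h1 := card_le_two_mul_le_median hSne (LinearQuery.rescaled n Q)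
        have h2 := Finset.card_filter_add_card_filter_not (s := S)
          fun E => LinearQuery.rescaled n Q E ≤ M
        rw [← hM] at h1
        omega

end MedianMechanism

/-! ### Choice of `α` for the median mechanism. -/

lemma two_mul_lt_exp {n k α m : ℝ} (hn : 0 < n) (hk : 2 ≤ k) (hα : 0 < α)
    (hm : n ^ 2 * Real.log k / α ^ 2 ≤ m) : 2 * k < Real.exp (m * (4 * α / n) ^ 2 / 4) := by
  have h1 : 4 * Real.log k ≤ m * (4 * α / n) ^ 2 / 4 := by
    calc 4 * Real.log k = n ^ 2 * Real.log k / α ^ 2 * (4 * α / n) ^ 2 / 4 := by field_simp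
      _ ≤ _ := by gcongr
  have h2 : Real.exp (4 * Real.log k) = k ^ 4 := by
    rw [mul_comm, Real.exp_mul, Real.exp_log (by linarith)]
    norm_cast
  refine lt_of_lt_of_le ?_ (Real.exp_le_exp.2 h1)
  rw [h2]
  have h3 : (2 : ℝ) ^ 3 ≤ k ^ 3 := pow_le_pow_left₀ (by norm_num) hk 3
  nlinarith

lemma medianRule_eval_init_mem {X : Type*} [Fintype X] (hX : 1 ≤ Fintype.card X) (n k : ℕ) (α : ℝ)
    (Q : LinearQuery X) :
    0 ≤ (medianRule X n k α).eval Q (medianRule X n k α).init ∧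
      (medianRule X n k α).eval Q (medianRule X n k α).init ≤ n := by
  classical
  have hne : (medianRule X n k α).init.Nonempty := by
    obtain ⟨x⟩ : Nonempty X := Fintype.card_pos_iff.1 (by omega)
    refine ⟨histogram fun _ : Fin (medianDbSize n k α) => x, ?_⟩
    simp only [medianRule, Finset.mem_piAntidiag, Finset.mem_univ, implies_true, and_true]
    exact size_histogram _
  exact median_mem hne fun E _ => Q.rescaled_mem n E

set_option maxHeartbeats 800000 in
lemma medianRule_release {X : Type u} [Fintype X] {n k : ℕ} {ε δ β : ℝ} (hX : 2 ≤ Fintype.card X)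
    (hn : 1 ≤ n) (hε : 0 < ε) (hε1 : ε ≤ 1) (hδ : 0 < δ) (hδ1 : δ ≤ 1) (hβ : 0 < β) (hβ1 : β ≤ 1)
    (hk : 2 ≤ k) :
    ∃ α : ℝ, 0 < α ∧
      ReleaseIsPrivate.{v} (medianRule X n k α) (medianBudget X n k α) ε δ β k ∧
      ReleaseIsAccurate.{v} (medianRule X n k α) (medianBudget X n k α) ε δ β k n
        (640 * (√n * (Real.log (Fintype.card X) * Real.log k) ^ (1 / 4 : ℝ) *
          √(Real.log (4 / δ) * Real.log (k / β)) / √ε)) := by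
  classical
  have hn0 : (0 : ℝ) < n := by exact_mod_cast hn
  have hX0 : (2 : ℝ) ≤ Fintype.card X := by exact_mod_cast hX
  have hk0 : (2 : ℝ) ≤ k := by exact_mod_cast hk
  have hkβ : 2 ≤ k / β := by rw [le_div_iff₀ hβ]; linarith
  have hl2 := Real.log_two_gt_d9
  have hl2' : Real.log 2 ≤ 1 := by linarith [Real.log_two_lt_d9]
  set ℓ := Real.log (Fintype.card X) with hℓ
  have hℓ2 : Real.log 2 ≤ ℓ := Real.log_le_log (by norm_num) hX0
  have hℓ0 : 0 < ℓ := by linarith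
  set κ := Real.log k with hκ
  have hκ2 : Real.log 2 ≤ κ := Real.log_le_log (by norm_num) hk0
  have hκ0 : 0 < κ := by linarith
  set L := Real.log (4 / δ) with hL
  have hL1 : 1 < L := one_lt_log_four_div hδ hδ1
  set Λ := Real.log (k / β) with hΛ
  have hΛ0 : 0 < Λ := Real.log_pos (by linarith)
  set Λ' := Real.log (2 * k / β) with hΛ'
  have hΛΛ' : Λ' ≤ 2 * Λ := log_two_mul_div_le hkβ
  have hΛ'0 : 0 < Λ' := Real.log_pos (by rw [mul_div_assoc]; linarith)
  set W := 4000 * n * √(ℓ * κ) * L * Λ' / ε with hW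
  have hW0 : 0 < W := by positivity
  set α₀ := √(W / 8) with hα₀
  have hα₀0 : 0 < α₀ := Real.sqrt_pos.2 (by positivity)
  have hα₀2 : α₀ ^ 2 = W / 8 := Real.sq_sqrt (by positivity)
  -- Uncapped, `8α₀ ≤ T ≤ 16α₀`: the sampling error `4α` is below `3T/4`, and `5T/4 ≤ 20α₀`, whence
  -- `640 = 20 · 32` with `1000 ≤ 32²`. The cap gives `4α/n ≤ 2` for the sampling lemma and database
  -- size at least two.
  set α := min α₀ (n / 2) with hα
  have hα0 : 0 < α := lt_min hα₀0 (by positivity)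
  have hαn : α ≤ n / 2 := min_le_right _ _
  set v := (n : ℝ) ^ 2 * κ / α ^ 2 with hv
  have hv2 : 2 ≤ v := by
    have h1 : α ^ 2 ≤ (n / 2) ^ 2 := pow_le_pow_left₀ hα0.le hαn 2
    rw [hv, le_div_iff₀ (by positivity)]
    nlinarith [pow_pos hn0 2]
  set m := medianDbSize n k α with hm
  have hmv : v ≤ m := Nat.le_ceil _
  have hmv' : (m : ℝ) ≤ 2 * v := by
    have : (m : ℝ) < v + 1 := Nat.ceil_lt_add_one (by linarith)
    linarith
  have hm2 : 2 ≤ m := by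
    have : (2 : ℝ) ≤ m := hv2.trans hmv
    exact_mod_cast this
  have hBeq : medianBudget X n k α = m * (ℓ / Real.log 2) := rfl
  have hBlo : v * ℓ ≤ medianBudget X n k α := by
    have h1 : ℓ ≤ ℓ / Real.log 2 := by
      rw [le_div_iff₀ (by linarith)]
      exact mul_le_of_le_one_right hℓ0.le hl2'
    rw [hBeq]
    gcongr
  -- One factor 2 comes from rounding up the database size, the other from `1/log 2 ≤ 2`.
  have hBup : medianBudget X n k α ≤ 2 ^ 2 * (v * ℓ) := by
    have h1 : ℓ / Real.log 2 ≤ 2 * ℓ := by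
      rw [div_le_iff₀ (by linarith)]
      nlinarith
    rw [hBeq]
    calc (m : ℝ) * (ℓ / Real.log 2) ≤ (2 * v) * (2 * ℓ) := by gcongr
      _ = _ := by ring
  have hB : 1 ≤ medianBudget X n k α := by nlinarith
  set T := updateThreshold (medianBudget X n k α) ε δ β k with hTdef
  have hT : T = √(medianBudget X n k α) * (4000 * L * Λ' / ε) := by
    rw [hTdef, updateThreshold, noiseScale]
    ring
  have hvℓ : √(v * ℓ) = n * √(ℓ * κ) / α := by
    rw [hv, show (n : ℝ) ^ 2 * κ / α ^ 2 * ℓ = (n / α) ^ 2 * (ℓ * κ) by ring,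
      Real.sqrt_mul (sq_nonneg _), Real.sqrt_sq (by positivity)]
    ring
  have hWα : W / α = √(v * ℓ) * (4000 * L * Λ' / ε) := by
    rw [hvℓ, hW]
    ring
  have hTlo : W / α ≤ T := by
    rw [hT, hWα]
    gcongr
  have hTup : T ≤ 2 * (W / α) := by
    have h1 := Real.sqrt_le_sqrt hBup
    rw [Real.sqrt_mul (by positivity), Real.sqrt_sq (by norm_num)] at h1
    rw [hT, hWα, ← mul_assoc]
    gcongr
  have hTα : 8 * α ≤ W / α := by
    have : α * α ≤ α₀ * α₀ := mul_self_le_mul_self hα0.le (min_le_left _ _)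
    rw [le_div_iff₀ hα0]
    linarith
  have hK : 20 * α₀ ≤ 640 * (√n * (ℓ * κ) ^ (1 / 4 : ℝ) * √(L * Λ) / √ε) := by
    have h1 : W / 8 ≤ 32 ^ 2 * (n * √(ℓ * κ) * (L * Λ) / ε) := by
      calc W / 8 = 500 * (n * √(ℓ * κ) * (L * Λ') / ε) := by rw [hW]; ring
        _ ≤ 500 * (n * √(ℓ * κ) * (L * (2 * Λ)) / ε) := by gcongr
        _ = 1000 * (n * √(ℓ * κ) * (L * Λ) / ε) := by ring
        _ ≤ _ := by gcongr; norm_num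
    have h2 := sqrt_le_error_scale (by norm_num) hn0.le (by positivity) (by positivity) h1
    linarith
  refine ⟨α, hα0, releaseIsPrivate (medianRule_isMeasurable n k α) hB hε hε1 hδ hδ1 β k,
    releaseIsAccurate (by linarith) hε hδ hδ1 hβ hβ1 (by omega) fun D hD Qs => ?_⟩
  rcases le_total α₀ (n / 2) with h | h
  · have hαα : α = α₀ := min_eq_left h
    have hWα₀ : W / α = 8 * α := by
      rw [hαα, div_eq_iff hα₀0.ne']
      linarith
    have hτ : 4 * α / n ≤ 2 := by
      rw [div_le_iff₀ hn0]
      linarith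
    obtain ⟨E, hE, hED⟩ := exists_rescaled_approx (m := m) (τ := 4 * α / n) hn (by omega) hD Qs
      (by positivity) hτ (two_mul_lt_exp hn0 hk0 hα0 hmv)
    refine ⟨_, medianInvariant_accuracy (b := n * (4 * α / n)) hX hm2 hE hED (by linarith) ?_ ?_⟩
    · rw [mul_div_cancel₀ _ hn0.ne']
      linarith
    · linarith
  -- Capped case: `T ≥ 8α = 4n`, so no update can occur, and `n = 2α ≤ 2α₀`.
  · have hαα : α = n / 2 := min_eq_right h
    exact ⟨_, AccuracyInvariant.of_le hD (by linarith) (by linarith) (by linarith)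
      (medianRule_eval_init_mem (by omega) n k α) _⟩

theorem mainTheorem5 :
    (∃ K : ℝ, 0 < K ∧
      ∀ (X : Type u) [Fintype X] (n k : ℕ) (ε δ β : ℝ),
        2 ≤ Fintype.card X → 1 ≤ n → 0 < ε → ε ≤ 1 → 0 < δ → δ ≤ 1 → 0 < β → β ≤ 1 →
        2 ≤ k / β →
        ∃ α : ℝ, 0 < α ∧
          ReleaseIsPrivate.{v} (mwRule X n α) (mwBudget X n α) ε δ β k ∧
          ReleaseIsAccurate.{v} (mwRule X n α) (mwBudget X n α) ε δ β k n
            (K * (√n * Real.log (Fintype.card X) ^ (1 / 4 : ℝ) *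
              √(Real.log (4 / δ) * Real.log (k / β)) / √ε))) ∧
    (∃ K : ℝ, 0 < K ∧
      ∀ (X : Type u) [Fintype X] (n k : ℕ) (ε δ β : ℝ),
        2 ≤ Fintype.card X → 1 ≤ n → 0 < ε → ε ≤ 1 → 0 < δ → δ ≤ 1 → 0 < β → β ≤ 1 →
        2 ≤ k →
        ∃ α : ℝ, 0 < α ∧
          ReleaseIsPrivate.{v} (medianRule X n k α) (medianBudget X n k α) ε δ β k ∧
          ReleaseIsAccurate.{v} (medianRule X n k α) (medianBudget X n k α) ε δ β k n
            (K * (√n * (Real.log (Fintype.card X) * Real.log k) ^ (1 / 4 : ℝ) *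
              √(Real.log (4 / δ) * Real.log (k / β)) / √ε))) := by
  refine ⟨⟨225, by norm_num, ?_⟩, ⟨640, by norm_num, ?_⟩⟩
  · intro X _ n k ε δ β hX hn hε hε1 hδ hδ1 hβ hβ1 hkβ
    exact mwRule_release hX hn hε hε1 hδ hδ1 hβ hβ1 hkβ
  · intro X _ n k ε δ β hX hn hε hε1 hδ hδ1 hβ hβ1 hk
    exact medianRule_release hX hn hε hε1 hδ hδ1 hβ hβ1 hk
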